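/- Let $K\in\mathbb N$, let $h=(h_1,\dots,h_K)\in\mathbb C^K\setminus\{0\}$ be the channel coefficients and let $\sigma_1,\sigma_2>0$. Let $X\sim\mathcal{CN}(0,1)$, $Z\sim\mathcal{CN}(0,\sigma_1^2)$ and $N\sim\mathcal N(0,\sigma_2^2)$ be independent random variables, the first two complex and circularly symmetric, the last real. For a received power $P>0$ and power splitting ratios $\rho\in[0,1]^K$ put $\Theta_1=\sum_{k}\rho_k|h_k|^2$, $\Theta_2=\sum_{k}(1-\rho_k)^2|h_k|^4$, and let $$Y_1=\sqrt{\Theta_1}\,\sqrt P\,X+Z,\qquad Y_2=\sqrt{\Theta_2}\,P\,|X|^2+N$$ be the output of the $K$-antenna splitting receiver. Let $I_P(\rho)=I(\sqrt P X;\,Y_1,Y_2)$ be the mutual information (in bits). The cases $\rho=\mathbf 1=(1,\dots,1)$ and $\rho=\mathbf 0=(0,\dots,0)$ are the conventional coherent and non-coherent receivers. The joint processing gain is $$G_P=\frac{\sup\{I_P(\rho):\rho\in[0,1]^K\}}{\max\{I_P(\mathbf 0),I_P(\mathbf 1)\}}.$$ Let $\mathrm{SNR}=\min\Bigl\{\frac{P}{\sigma_1^2}\sum_k|h_k|^2,\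 \frac{P}{\sigma_2}\sqrt{\sum_k|h_k|^4}\Bigr\}$, and let $\mathrm{SNR}\to\infty$ by letting $P\to\infty$ with $h,\sigma_1,\sigma_2$ fixed. Then $$\lim_{\mathrm{SNR}\to\infty}G_P=\frac32 .$$ Moreover, if $h_k\neq0$ for all $k$, then for every fixed $\rho\in[0,1]^K\setminus\{\mathbf 0,\mathbf 1\}$ $$\lim_{\mathrm{SNR}\to\infty}\frac{I_P(\rho)}{\max\{I_P(\mathbf 0),I_P(\mathbf 1)\}}=\frac32 .$$ -/

import Mathlib

open MeasureTheory ProbabilityTheory Filter Topology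
open scoped ENNReal NNReal

noncomputable section

namespace SplittingReceiver

/-- The circularly symmetric complex Gaussian law `CN(0, v)`: the real and the imaginary part are
independent, real Gaussian, centred, of variance `v / 2` each. -/
def complexGaussian (v : ℝ≥0) : Measure ℂ :=
  ((gaussianReal 0 (v / 2)).prod (gaussianReal 0 (v / 2))).map Complex.measurableEquivRealProd.symm

/-- The mutual information `I(U; V)`, in bits: the Kullback-Leibler divergence (in nats) of the
joint law of `(U, V)` from the product of the two marginal laws, divided by `log 2`. -/
def mutualInfo {Ω α β : Type*} [MeasurableSpace Ω] [MeasurableSpace α] [MeasurableSpace β]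
    (μ : Measure Ω) (U : Ω → α) (V : Ω → β) : ℝ≥0∞ :=
  InformationTheory.klDiv (μ.map (fun ω => (U ω, V ω))) ((μ.map U).prod (μ.map V)) /
    ENNReal.ofReal (Real.log 2)

variable {K : ℕ}

/-- `Θ₁ = ∑ₖ ρₖ |hₖ|²`. -/
def Theta1 (h : Fin K → ℂ) (ρ : Fin K → ℝ) : ℝ := ∑ k, ρ k * ‖h k‖ ^ 2

/-- `Θ₂ = ∑ₖ (1 - ρₖ)² |hₖ|⁴`. -/
def Theta2 (h : Fin K → ℂ) (ρ : Fin K → ℝ) : ℝ := ∑ k, (1 - ρ k) ^ 2 * ‖h k‖ ^ 4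

/-- The operating SNR `min {H₂ P / σ₁², √H₄ P / σ₂}` with `H₂ = ∑ₖ |hₖ|²` and `H₄ = ∑ₖ |hₖ|⁴`,
for received power `P` and noise standard deviations `σ₁` (coherent) and `σ₂` (non-coherent). -/
def snr (h : Fin K → ℂ) (σ₁ σ₂ : ℝ≥0) (P : ℝ) : ℝ :=
  min ((∑ k, ‖h k‖ ^ 2) * P / (σ₁ : ℝ) ^ 2) (√(∑ k, ‖h k‖ ^ 4) * P / (σ₂ : ℝ))

/-- The output `(Y₁, Y₂) = (√Θ₁ u + z, √Θ₂ |u|² + n)` of the splitting channel (after maximal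
ratio combining and normalisation) for the input `u` and the noises `z` and `n`. -/
def channelOutput (h : Fin K → ℂ) (ρ : Fin K → ℝ) (u z : ℂ) (n : ℝ) : ℂ × ℝ :=
  ((√(Theta1 h ρ) : ℂ) * u + z, √(Theta2 h ρ) * ‖u‖ ^ 2 + n)

variable {Ω : Type*} [MeasurableSpace Ω]

/-- The mutual information `I(√P X; Y₁, Y₂)` of the splitting channel with power splitting
ratios `ρ` and received power `P`. -/
def splittingInfo (μ : Measure Ω) (X Z : Ω → ℂ) (N : Ω → ℝ) (h : Fin K → ℂ) (P : ℝ)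
    (ρ : Fin K → ℝ) : ℝ≥0∞ :=
  mutualInfo μ (fun ω => (√P : ℂ) * X ω)
    (fun ω => channelOutput h ρ ((√P : ℂ) * X ω) (Z ω) (N ω))

/-- The larger of the mutual informations of the two conventional receivers, the non-coherent one
(`ρ = 0`) and the coherent one (`ρ = 1`). -/
def conventionalInfo (μ : Measure Ω) (X Z : Ω → ℂ) (N : Ω → ℝ) (h : Fin K → ℂ) (P : ℝ) : ℝ≥0∞ :=
  max (splittingInfo μ X Z N h P 0) (splittingInfo μ X Z N h P 1)

/-- The joint processing gain: the supremum of the mutual information over all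
`ρ ∈ [0, 1]^K`, divided by that of the better conventional receiver. -/
def jointProcessingGain (μ : Measure Ω) (X Z : Ω → ℂ) (N : Ω → ℝ) (h : Fin K → ℂ) (P : ℝ) :
    ℝ≥0∞ :=
  (⨆ ρ ∈ Set.Icc (0 : Fin K → ℝ) 1, splittingInfo μ X Z N h P ρ) / conventionalInfo μ X Z N h P

end SplittingReceiver

end

/-! For a channel `V = T U + W` whose noise has density `p`, the mutual information in nats is `E
log p(W) - E log f(V)`, where `f` is the density of `V`. The noise term does not depend on `P`, so
everything rests on the growth of `-E log f(V)`, needed only up to `O(1)`: conventional receivers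
give `log P`, genuinely splitting ones `3/2 log P`.

Upper bounds come from Gibbs' inequality: `f` may be replaced by any positive trial density
(`klDiv_additive_noise_le`). Noiseless outputs lie on the paraboloid `y₂ = (b/a²)|y₁|²`, where `a =
√Θ₁` and `b = √Θ₂`. Around it, `Y₁` spreads over an area of order `P`, and `Y₂` deviates by order
`√P`, because the noise of `Y₁` is amplified by `|Y₁|`. A Gaussian trial density with these scales
costs `log P + 1/2 log P`. If one branch is dead, uncorrelated Gaussians cost only `log P`.
`exists_channelInfo_le` makes the constants uniform in `ρ`, as the supremum requires.

Lower bounds come from pointwise bounds on `f` (`le_klDiv_additive_noise`). The coherent receiver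
has `f ≤ const / P`. If both branches are alive, the quadratic output improves this to `f(v) ≤ const
/ (P (1 + |Im v₁|))` (`mul_lintegral_noisePDF_le`). Since `|Im Y₁|` is of order `√P |Im X|` and `log
|Im X|` is integrable, an extra `1/2 log P` appears (`exists_le_channelInfo`). The additive
constants disappear in the quotient. -/

namespace SplittingReceiver

/-! ### Information of additive noise channels -/

section AdditiveNoise

variable {Ω α G : Type*} [MeasurableSpace Ω] [MeasurableSpace α] [MeasurableSpace G]
  [AddCommGroup G] [MeasurableSub₂ G]

/-- The density of the output `T U + W` of an additive noise channel whose input has law `κ` and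
whose noise has density `p`. -/
noncomputable def outputDensity (κ : Measure α) (T : α → G) (p : G → ℝ) (v : G) : ℝ≥0∞ :=
  ∫⁻ u, ENNReal.ofReal (p (v - T u)) ∂κ

lemma measurable_outputDensity (κ : Measure α) [SFinite κ] {T : α → G} (hT : Measurable T)
    {p : G → ℝ} (hp : Measurable p) : Measurable (outputDensity κ T p) := by
  unfold outputDensity
  have : Measurable fun x : G × α => ENNReal.ofReal (p (x.1 - T x.2)) := by fun_prop
  exact this.lintegral_prod_right'

variable {T : α → G} {p : G → ℝ}

lemma outputDensity_pos (κ : Measure α) [IsProbabilityMeasure κ] (hT : Measurable T)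
    (hp : Measurable p) (hpos : ∀ w, 0 < p w) (v : G) : outputDensity κ T p v ≠ 0 := by
  unfold outputDensity
  rw [Ne, lintegral_eq_zero_iff (by fun_prop)]
  intro h
  have : ∀ᵐ u ∂κ, False := by
    filter_upwards [h] with u hu
    simpa using not_le.2 (hpos (v - T u)) (by simpa using hu)
  exact (this.exists).elim fun _ h => h

lemma outputDensity_le {α G : Type*} [MeasurableSpace α] [AddCommGroup G] {T : α → G}
    {p : G → ℝ} (κ : Measure α) [IsProbabilityMeasure κ] {C : ℝ}
    (hC : ∀ w, p w ≤ C) (v : G) : outputDensity κ T p v ≤ ENNReal.ofReal C := by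
  unfold outputDensity
  calc _ ≤ ∫⁻ _, ENNReal.ofReal C ∂κ := lintegral_mono fun u => ENNReal.ofReal_le_ofReal (hC _)
    _ = _ := by simp

variable [MeasurableAdd₂ G]

/-- On the fibre over a fixed input `u`, the map is translation by `T u`, which preserves `m`;
Tonelli assembles the fibres. -/
lemma map_additive_noise (κ : Measure α) [SFinite κ] (m : Measure G) [SFinite m]
    [m.IsAddLeftInvariant] (hT : Measurable T) (hp : Measurable p) :
    (κ.prod (m.withDensity fun w => ENNReal.ofReal (p w))).map (fun x => (x.1, T x.1 + x.2)) =
      (κ.prod m).withDensity fun x => ENNReal.ofReal (p (x.2 - T x.1)) := by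
  have hmeas : Measurable fun x : α × G => (x.1, T x.1 + x.2) := by fun_prop
  ext s hs
  rw [Measure.map_apply hmeas hs, withDensity_apply _ hs, prod_withDensity_right (by fun_prop),
    withDensity_apply _ (hmeas hs), ← lintegral_indicator hs, ← lintegral_indicator (hmeas hs),
    lintegral_prod _ ((Measurable.indicator (by fun_prop) (hmeas hs)).aemeasurable),
    lintegral_prod _ ((Measurable.indicator (by fun_prop) hs).aemeasurable)]
  refine lintegral_congr fun u => ?_
  refine Eq.trans ?_ (lintegral_add_left_eq_self (μ := m) _ (T u))
  refine lintegral_congr fun w => ?_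
  by_cases hw : (u, T u + w) ∈ s
  · rw [Set.indicator_of_mem (by exact hw), Set.indicator_of_mem hw]
    simp
  · rw [Set.indicator_of_notMem (by exact hw), Set.indicator_of_notMem hw]

variable {μ : Measure Ω} [IsProbabilityMeasure μ] {m : Measure G} [SigmaFinite m]
  [m.IsAddLeftInvariant] {U : Ω → α} {W : Ω → G}

lemma map_prodMk_additive_noise (hU : AEMeasurable U μ)
    (hW : HasLaw W (m.withDensity fun w => ENNReal.ofReal (p w)) μ) (hUW : IndepFun U W μ)
    (hT : Measurable T) (hp : Measurable p) :
    μ.map (fun ω => (U ω, T (U ω) + W ω)) =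
      ((μ.map U).prod m).withDensity fun x => ENNReal.ofReal (p (x.2 - T x.1)) := by
  have : IsProbabilityMeasure (μ.map U) := Measure.isProbabilityMeasure_map hU
  have h := (indepFun_iff_map_prod_eq_prod_map_map hU hW.aemeasurable).1 hUW
  rw [hW.map_eq] at h
  rw [← map_additive_noise _ _ hT hp, ← h, AEMeasurable.map_map_of_aemeasurable]
  · rfl
  · fun_prop
  · exact hU.prodMk hW.aemeasurable

lemma map_additive_noise_output (hU : AEMeasurable U μ)
    (hW : HasLaw W (m.withDensity fun w => ENNReal.ofReal (p w)) μ) (hUW : IndepFun U W μ)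
    (hT : Measurable T) (hp : Measurable p) :
    μ.map (fun ω => T (U ω) + W ω) = m.withDensity (outputDensity (μ.map U) T p) := by
  have : IsProbabilityMeasure (μ.map U) := Measure.isProbabilityMeasure_map hU
  have h := map_prodMk_additive_noise hU hW hUW hT hp
  have h2 := congrArg (Measure.map Prod.snd) h
  have hV : AEMeasurable (fun ω => T (U ω) + W ω) μ :=
    (hT.comp_aemeasurable hU).add hW.aemeasurable
  rw [AEMeasurable.map_map_of_aemeasurable (by fun_prop) (hU.prodMk hV)] at h2
  change μ.map (fun ω => T (U ω) + W ω) = _ at h2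
  rw [h2]
  ext s hs
  rw [Measure.map_apply measurable_snd hs, withDensity_apply _ (measurable_snd hs),
    withDensity_apply _ hs, ← lintegral_indicator hs, ← lintegral_indicator (measurable_snd hs),
    lintegral_prod_symm _
      ((Measurable.indicator (by fun_prop) (measurable_snd hs)).aemeasurable)]
  refine lintegral_congr fun v => ?_
  by_cases hv : v ∈ s
  · simp only [hv, Set.indicator_of_mem, outputDensity]
    refine lintegral_congr fun u => ?_
    rw [Set.indicator_of_mem (by exact hv)]
  · simp only [hv, Set.indicator_of_notMem, not_false_eq_true]
    rw [← lintegral_zero (μ := μ.map U)]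
    refine lintegral_congr fun u => ?_
    rw [Set.indicator_of_notMem (by exact hv)]

/-- The divergence of the joint law of input and output from the product of the marginals is the
expectation of the information density. -/
lemma klDiv_additive_noise (hU : AEMeasurable U μ)
    (hW : HasLaw W (m.withDensity fun w => ENNReal.ofReal (p w)) μ) (hUW : IndepFun U W μ)
    (hT : Measurable T) (hp : Measurable p) (hpos : ∀ w, 0 < p w) {C : ℝ} (hC : ∀ w, p w ≤ C)
    {M : Ω → ℝ} (hM : M = fun ω => Real.log (p (W ω)) -
      Real.log (outputDensity (μ.map U) T p (T (U ω) + W ω)).toReal) :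
    (Integrable M μ → InformationTheory.klDiv (μ.map (fun ω => (U ω, T (U ω) + W ω)))
      ((μ.map U).prod (μ.map fun ω => T (U ω) + W ω)) = ENNReal.ofReal (∫ ω, M ω ∂μ)) ∧
    (¬ Integrable M μ → InformationTheory.klDiv (μ.map (fun ω => (U ω, T (U ω) + W ω)))
      ((μ.map U).prod (μ.map fun ω => T (U ω) + W ω)) = ∞) := by
  have : IsProbabilityMeasure (μ.map U) := Measure.isProbabilityMeasure_map hU
  have hV : AEMeasurable (fun ω => T (U ω) + W ω) μ :=
    (hT.comp_aemeasurable hU).add hW.aemeasurable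
  have hUV := hU.prodMk hV
  have : IsProbabilityMeasure (μ.map fun ω => T (U ω) + W ω) := Measure.isProbabilityMeasure_map hV
  have : IsProbabilityMeasure (μ.map fun ω => (U ω, T (U ω) + W ω)) :=
    Measure.isProbabilityMeasure_map hUV
  have hJ := map_prodMk_additive_noise hU hW hUW hT hp
  have hO := map_additive_noise_output hU hW hUW hT hp
  set J := μ.map (fun ω => (U ω, T (U ω) + W ω)) with hJdef
  set κ := μ.map U
  set O := μ.map fun ω => T (U ω) + W ω
  set g := outputDensity κ T p with hg
  have hgm : Measurable g := measurable_outputDensity κ hT hp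
  have hg0 : ∀ v, g v ≠ 0 := outputDensity_pos κ hT hp hpos
  have hgt : ∀ v, g v ≠ ∞ := fun v =>
    ((outputDensity_le κ hC v).trans_lt ENNReal.ofReal_lt_top).ne
  -- Joint law and product of marginals both have densities with respect to `κ.prod m`; their
  -- quotient is the Radon-Nikodym derivative, since `g` is positive and finite.
  have hQ : κ.prod O = (κ.prod m).withDensity fun x => g x.2 := by
    rw [hO, prod_withDensity_right hgm]
  have hJQ : J = (κ.prod O).withDensity
      fun x => ENNReal.ofReal (p (x.2 - T x.1)) / g x.2 := by
    rw [hQ, hJ, ← withDensity_mul _ (by fun_prop) (by fun_prop)]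
    congr 1
    ext x
    simp only [Pi.mul_apply]
    rw [ENNReal.mul_div_cancel (hg0 _) (hgt _)]
  have hac : J ≪ κ.prod O := by
    rw [hJQ]; exact withDensity_absolutelyContinuous _ _
  have hrn : J.rnDeriv (κ.prod O) =ᵐ[κ.prod O]
      fun x => ENNReal.ofReal (p (x.2 - T x.1)) / g x.2 := by
    conv_lhs => rw [hJQ]
    exact Measure.rnDeriv_withDensity _ (by fun_prop)
  have hllr : llr J (κ.prod O) ∘ (fun ω => (U ω, T (U ω) + W ω)) =ᵐ[μ] M := by
    have h1 := ae_of_ae_map hUV (hac.ae_le hrn)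
    filter_upwards [h1] with ω hω
    simp only [Function.comp_apply, llr, hM]
    rw [hω, ENNReal.toReal_div, Real.log_div]
    · simp [ENNReal.toReal_ofReal (hpos _).le]
    · simp [ENNReal.toReal_ofReal (hpos _).le, (hpos _).ne']
    · exact (ENNReal.toReal_pos (hg0 _) (hgt _)).ne'
  have hsm : AEStronglyMeasurable (llr J (κ.prod O)) J :=
    (measurable_llr _ _).aestronglyMeasurable
  have hint : Integrable (llr J (κ.prod O)) J ↔ Integrable M μ := by
    rw [← integrable_congr hllr, hJdef]
    exact integrable_map_measure hsm hUV
  constructor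
  · intro h
    rw [InformationTheory.klDiv_of_ac_of_integrable hac (hint.2 h)]
    have : ∫ x, llr J (κ.prod O) x ∂J = ∫ ω, M ω ∂μ := by
      rw [← integral_congr_ae hllr]
      conv_lhs => rw [hJdef]
      exact integral_map hUV hsm
    rw [this]
    simp
  · intro h
    exact InformationTheory.klDiv_of_not_integrable (mt hint.1 h)

/-- Upper bound: comparing with an auxiliary output density `g`. -/
lemma klDiv_additive_noise_le (hU : AEMeasurable U μ)
    (hW : HasLaw W (m.withDensity fun w => ENNReal.ofReal (p w)) μ) (hUW : IndepFun U W μ)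
    (hT : Measurable T) (hp : Measurable p) (hpos : ∀ w, 0 < p w) {C : ℝ} (hC : ∀ w, p w ≤ C)
    (hL : Integrable (fun ω => Real.log (p (W ω))) μ)
    {g : G → ℝ} (hg : Measurable g) (hgpos : ∀ v, 0 < g v)
    (hg1 : ∫⁻ v, ENNReal.ofReal (g v) ∂m ≤ 1) {A : ℝ} {F : Ω → ℝ} (hF : Integrable F μ)
    (hgF : ∀ ω, -Real.log (g (T (U ω) + W ω)) ≤ A + F ω) :
    InformationTheory.klDiv (μ.map (fun ω => (U ω, T (U ω) + W ω)))
      ((μ.map U).prod (μ.map fun ω => T (U ω) + W ω)) ≤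
      ENNReal.ofReal (∫ ω, Real.log (p (W ω)) ∂μ + A + ∫ ω, F ω ∂μ) := by
  have : IsProbabilityMeasure (μ.map U) := Measure.isProbabilityMeasure_map hU
  have hV : AEMeasurable (fun ω => T (U ω) + W ω) μ :=
    (hT.comp_aemeasurable hU).add hW.aemeasurable
  have hkl := klDiv_additive_noise hU hW hUW hT hp hpos hC rfl
  have hO := map_additive_noise_output hU hW hUW hT hp
  set f := outputDensity (μ.map U) T p with hf
  have hfm : Measurable f := measurable_outputDensity _ hT hp
  have hf0 : ∀ v, f v ≠ 0 := outputDensity_pos _ hT hp hpos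
  have hft : ∀ v, f v ≠ ∞ := fun v =>
    ((outputDensity_le _ hC v).trans_lt ENNReal.ofReal_lt_top).ne
  have hfpos : ∀ v, 0 < (f v).toReal := fun v => ENNReal.toReal_pos (hf0 v) (hft v)
  have hfC : ∀ v, (f v).toReal ≤ C := fun v =>
    ENNReal.toReal_le_of_le_ofReal ((hpos 0).le.trans (hC 0)) (outputDensity_le _ hC v)
  set V := fun ω => T (U ω) + W ω with hVdef
  -- `V` has density `f`, so the mean of `g(V) / f(V)` is the total mass of `g`.
  have hR : ∫⁻ ω, ENNReal.ofReal (g (V ω) / (f (V ω)).toReal) ∂μ ≤ 1 := by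
    have e : ∀ v, ENNReal.ofReal (g v / (f v).toReal) = (f v)⁻¹ * ENNReal.ofReal (g v) := by
      intro v
      rw [ENNReal.ofReal_div_of_pos (hfpos v), ENNReal.ofReal_toReal (hft v),
        ENNReal.div_eq_inv_mul]
    simp_rw [e]
    have h1 : ∫⁻ ω, (f (V ω))⁻¹ * ENNReal.ofReal (g (V ω)) ∂μ
        = ∫⁻ v, (f v)⁻¹ * ENNReal.ofReal (g v) ∂(μ.map V) :=
      (lintegral_map' (f := fun v => (f v)⁻¹ * ENNReal.ofReal (g v)) (by fun_prop) hV).symm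
    rw [h1, hO, lintegral_withDensity_eq_lintegral_mul _ hfm (by fun_prop)]
    refine le_trans (le_of_eq (lintegral_congr fun v => ?_)) hg1
    simp only [Pi.mul_apply]
    rw [← mul_assoc, ENNReal.mul_inv_cancel (hf0 v) (hft v), one_mul]
  set R := fun ω => g (V ω) / (f (V ω)).toReal with hRdef
  have hR0 : ∀ ω, 0 ≤ R ω := fun ω => div_nonneg (hgpos _).le (hfpos _).le
  have hRm : AEStronglyMeasurable R μ := by
    have : Measurable fun v => g v / (f v).toReal := by fun_prop
    exact (this.comp_aemeasurable hV).aestronglyMeasurable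
  have hRi : Integrable R μ :=
    (lintegral_ofReal_ne_top_iff_integrable hRm (ae_of_all _ hR0)).1
      (hR.trans_lt ENNReal.one_lt_top).ne
  have hR1 : ∫ ω, R ω ∂μ ≤ 1 := by
    rw [integral_eq_lintegral_of_nonneg_ae (ae_of_all _ hR0) hRm]
    exact ENNReal.toReal_le_of_le_ofReal zero_le_one (by simpa using hR)
  -- Gibbs' inequality before integration, from `log r ≤ r - 1` at `r = g / f`. With the bound `f ≤
  -- C` it also shows that `log f(V)` is integrable.
  have hlow : ∀ ω, -A - F ω + 1 - R ω ≤ Real.log (f (V ω)).toReal := by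
    intro ω
    have h1 := Real.log_le_sub_one_of_pos (div_pos (hgpos (V ω)) (hfpos (V ω)))
    rw [Real.log_div (hgpos _).ne' (hfpos _).ne'] at h1
    have h2 := hgF ω
    simp only [hRdef]
    linarith
  have hup : ∀ ω, Real.log (f (V ω)).toReal ≤ Real.log C := fun ω =>
    Real.log_le_log (hfpos _) (hfC _)
  have hmm : AEStronglyMeasurable (fun ω => Real.log (f (V ω)).toReal) μ := by
    have : Measurable fun v => Real.log (f v).toReal := by fun_prop
    exact (this.comp_aemeasurable hV).aestronglyMeasurable
  have hlowi : Integrable (fun ω => -A - F ω + 1 - R ω) μ :=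
    (((integrable_const _).sub hF).add (integrable_const _)).sub hRi
  have hMi : Integrable (fun ω => Real.log (f (V ω)).toReal) μ :=
    integrable_of_le_of_le hmm (ae_of_all _ hlow) (ae_of_all _ hup) hlowi (integrable_const _)
  rw [hkl.1 (hL.sub hMi)]
  refine ENNReal.ofReal_le_ofReal ?_
  rw [integral_sub hL hMi]
  have h3 : ∫ ω, (-A - F ω + 1 - R ω) ∂μ ≤ ∫ ω, Real.log (f (V ω)).toReal ∂μ :=
    integral_mono hlowi hMi hlow
  rw [integral_sub (f := fun ω => -A - F ω + 1)
      (((integrable_const _).sub hF).add (integrable_const _)) hRi,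
    integral_add (f := fun ω => -A - F ω) ((integrable_const _).sub hF) (integrable_const _),
    integral_sub (integrable_const _) hF] at h3
  simp at h3
  linarith

/-- Lower bound: the density of the output is at most `g`. -/
lemma le_klDiv_additive_noise (hU : AEMeasurable U μ)
    (hW : HasLaw W (m.withDensity fun w => ENNReal.ofReal (p w)) μ) (hUW : IndepFun U W μ)
    (hT : Measurable T) (hp : Measurable p) (hpos : ∀ w, 0 < p w) {C : ℝ} (hC : ∀ w, p w ≤ C)
    (hL : Integrable (fun ω => Real.log (p (W ω))) μ)
    {g : G → ℝ} (hgpos : ∀ v, 0 < g v)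
    (hg : ∀ v, outputDensity (μ.map U) T p v ≤ ENNReal.ofReal (g v))
    {A : ℝ} {F : Ω → ℝ} (hF : Integrable F μ)
    (hgF : ∀ᵐ ω ∂μ, A - F ω ≤ -Real.log (g (T (U ω) + W ω))) :
    ENNReal.ofReal (∫ ω, Real.log (p (W ω)) ∂μ + A - ∫ ω, F ω ∂μ) ≤
    InformationTheory.klDiv (μ.map (fun ω => (U ω, T (U ω) + W ω)))
      ((μ.map U).prod (μ.map fun ω => T (U ω) + W ω)) := by
  have : IsProbabilityMeasure (μ.map U) := Measure.isProbabilityMeasure_map hU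
  have hkl := klDiv_additive_noise hU hW hUW hT hp hpos hC rfl
  have hf0 : ∀ v, outputDensity (μ.map U) T p v ≠ 0 := outputDensity_pos _ hT hp hpos
  have hft : ∀ v, outputDensity (μ.map U) T p v ≠ ∞ := fun v =>
    ((outputDensity_le _ hC v).trans_lt ENNReal.ofReal_lt_top).ne
  -- Without integrability the divergence is infinite and nothing is left to prove.
  by_cases hi : Integrable (fun ω => Real.log (p (W ω)) -
      Real.log (outputDensity (μ.map U) T p (T (U ω) + W ω)).toReal) μ
  · rw [hkl.1 hi]
    refine ENNReal.ofReal_le_ofReal ?_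
    have hli := (hL.add (integrable_const A)).sub hF
    have h3 := integral_mono_ae hli hi (by
      filter_upwards [hgF] with ω hω
      have h1 : Real.log (outputDensity (μ.map U) T p (T (U ω) + W ω)).toReal ≤
          Real.log (g (T (U ω) + W ω)) :=
        Real.log_le_log (ENNReal.toReal_pos (hf0 _) (hft _))
          (ENNReal.toReal_le_of_le_ofReal (hgpos _).le (hg _))
      simp only [Pi.sub_apply, Pi.add_apply]
      linarith)
    simp only [Pi.sub_apply, Pi.add_apply] at h3
    rw [integral_sub (f := fun ω => Real.log (p (W ω)) + A)
      (hL.add (integrable_const A)) hF, integral_add hL (integrable_const A)] at h3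
    simpa using h3
  · rw [hkl.2 hi]
    exact le_top

end AdditiveNoise

/-! ### One-dimensional changes of variables -/

section Substitution

lemma setLIntegral_abs_deriv_mul_comp_le {s : Set ℝ} (hs : MeasurableSet s) {f f' : ℝ → ℝ}
    (hf : ∀ x ∈ s, HasDerivWithinAt f (f' x) s x) (hinj : Set.InjOn f s) (φ : ℝ → ℝ≥0∞) :
    ∫⁻ x in s, ENNReal.ofReal |f' x| * φ (f x) ≤ ∫⁻ x, φ x := by
  rw [← lintegral_image_eq_lintegral_abs_deriv_mul hs hf hinj]
  exact setLIntegral_le_lintegral _ _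

lemma mul_lintegral_comp_sub_mul_le {α : ℝ} (hα : 0 < α) (s : ℝ) {φ : ℝ → ℝ≥0∞}
    (hφ : Measurable φ) :
    ENNReal.ofReal α * ∫⁻ x, φ (s - α * x) ≤ ∫⁻ x, φ x := by
  have h := setLIntegral_abs_deriv_mul_comp_le (s := Set.univ) MeasurableSet.univ
    (f := fun x => s - α * x) (f' := fun _ => -α)
    (fun x _ => HasDerivAt.hasDerivWithinAt
      (by simpa using ((hasDerivAt_id x).const_mul α).const_sub s))
    (fun x _ y _ hxy => by simpa [hα.ne'] using hxy) φ
  rw [Measure.restrict_univ, lintegral_const_mul _ (by fun_prop)] at h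
  simpa [abs_of_pos hα] using h

/-- The substitution `w = t - β x²` is injective on each half-line with Jacobian `2β|x|`. Adding the
two half-lines puts a factor `2` on both sides, which cancels. -/
lemma lintegral_abs_mul_comp_sub_mul_sq_le {β : ℝ} (hβ : 0 < β) (t : ℝ) {φ : ℝ → ℝ≥0∞}
    (hφ : Measurable φ) :
    ENNReal.ofReal β * ∫⁻ x, ENNReal.ofReal |x| * φ (t - β * x ^ 2) ≤ ∫⁻ x, φ x := by
  have hd : ∀ x : ℝ, HasDerivAt (fun x => t - β * x ^ 2) (-(β * (2 * x))) x := fun x => by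
    simpa using ((hasDerivAt_pow 2 x).const_mul β).const_sub t
  have hpos := setLIntegral_abs_deriv_mul_comp_le (s := Set.Ici 0) measurableSet_Ici
    (f := fun x => t - β * x ^ 2) (f' := fun x => -(β * (2 * x)))
    (fun x _ => (hd x).hasDerivWithinAt) (fun x hx y hy hxy => by
      have : x ^ 2 = y ^ 2 := by simpa [hβ.ne'] using hxy
      exact (sq_eq_sq₀ hx hy).1 this) φ
  have hneg := setLIntegral_abs_deriv_mul_comp_le (s := Set.Iio 0) measurableSet_Iio
    (f := fun x => t - β * x ^ 2) (f' := fun x => -(β * (2 * x)))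
    (fun x _ => (hd x).hasDerivWithinAt) (fun x hx y hy hxy => by
      have : x ^ 2 = y ^ 2 := by simpa [hβ.ne'] using hxy
      have hx' : x < 0 := hx
      have hy' : y < 0 := hy
      nlinarith [sq_eq_sq_iff_eq_or_eq_neg.1 this, mul_pos_of_neg_of_neg hx' hy',
        sq_eq_sq_iff_abs_eq_abs x y |>.1 this, abs_of_neg hx', abs_of_neg hy']) φ
  have hsum := add_le_add hpos hneg
  have hc : (Set.Iio (0 : ℝ)) = (Set.Ici 0)ᶜ := by simp
  rw [hc, lintegral_add_compl _ measurableSet_Ici] at hsum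
  have e : ∀ x : ℝ, ENNReal.ofReal |-(β * (2 * x))| * φ (t - β * x ^ 2) =
      2 * (ENNReal.ofReal β * (ENNReal.ofReal |x| * φ (t - β * x ^ 2))) := fun x => by
    rw [abs_neg, abs_mul, abs_mul, abs_of_pos hβ, abs_two, ENNReal.ofReal_mul hβ.le,
      ENNReal.ofReal_mul zero_le_two, ENNReal.ofReal_ofNat]
    ring
  simp_rw [e] at hsum
  rw [lintegral_const_mul _ (by fun_prop), lintegral_const_mul _ (by fun_prop), ← two_mul] at hsum
  exact (ENNReal.mul_le_mul_iff_right (by simp) (by simp)).1 hsum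

/-- One dimensional version of the bound on the output density of the splitting channel. -/
lemma mul_lintegral_quadratic_le {q r : ℝ → ℝ} (hq : Measurable q) (hr : Measurable r)
    (hq0 : ∀ x, 0 ≤ q x) (hr0 : ∀ x, 0 ≤ r x) {Q R D : ℝ} (hD0 : 0 ≤ D)
    (hQ : ∀ x, q x ≤ Q) (hR : ∀ x, r x ≤ R)
    (hD : ∫⁻ x, ENNReal.ofReal ((1 + |x|) * q x) ≤ ENNReal.ofReal D)
    (hr1 : ∫⁻ x, ENNReal.ofReal (r x) ≤ 1) {α β : ℝ} (hα : 0 < α) (hβ : 0 < β) (s t : ℝ) :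
    ENNReal.ofReal (1 + |s|) * ∫⁻ x, ENNReal.ofReal (q (s - α * x) * r (t - β * x ^ 2)) ≤
      ENNReal.ofReal (R * D / α + α * Q / β) := by
  have hQ0 : 0 ≤ Q := (hq0 0).trans (hQ 0)
  have hR0 : 0 ≤ R := (hr0 0).trans (hR 0)
  have h1 := mul_lintegral_comp_sub_mul_le hα s
    (φ := fun x => ENNReal.ofReal ((1 + |x|) * q x)) (by fun_prop)
  have h2 := lintegral_abs_mul_comp_sub_mul_sq_le hβ t
    (φ := fun x => ENNReal.ofReal (r x)) (by fun_prop)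
  have h1' : ∫⁻ x, ENNReal.ofReal ((1 + |s - α * x|) * q (s - α * x)) ≤
      ENNReal.ofReal D / ENNReal.ofReal α := by
    rw [ENNReal.le_div_iff_mul_le (by simp [hα]) (by simp), mul_comm]
    exact h1.trans hD
  have h2' : ∫⁻ x, ENNReal.ofReal |x| * ENNReal.ofReal (r (t - β * x ^ 2)) ≤
      1 / ENNReal.ofReal β := by
    rw [ENNReal.le_div_iff_mul_le (by simp [hβ]) (by simp), mul_comm]
    exact h2.trans hr1
  rw [← lintegral_const_mul _ (by fun_prop)]
  calc ∫⁻ x, ENNReal.ofReal (1 + |s|) * ENNReal.ofReal (q (s - α * x) * r (t - β * x ^ 2))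
      ≤ ∫⁻ x, (ENNReal.ofReal R * ENNReal.ofReal ((1 + |s - α * x|) * q (s - α * x)) +
          ENNReal.ofReal (α * Q) * (ENNReal.ofReal |x| * ENNReal.ofReal (r (t - β * x ^ 2)))) := by
        refine lintegral_mono fun x => ?_
        rw [← ENNReal.ofReal_mul (by positivity), ← ENNReal.ofReal_mul hR0,
          ← ENNReal.ofReal_mul (abs_nonneg _), ← ENNReal.ofReal_mul (by positivity),
          ← ENNReal.ofReal_add (mul_nonneg hR0 (mul_nonneg (by positivity) (hq0 _)))
            (mul_nonneg (by positivity) (mul_nonneg (abs_nonneg _) (hr0 _)))]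
        refine ENNReal.ofReal_le_ofReal ?_
        -- This splits the weight `1 + |s|`: the part `1 + |s - αx|` is absorbed by the first moment
        -- of `q`, with `r ≤ R`; the part `α|x|` is the Jacobian of the quadratic substitution, with
        -- `q ≤ Q`.
        have hs : |s| ≤ |s - α * x| + α * |x| := by
          have := abs_add_le (s - α * x) (α * x)
          rw [abs_mul, abs_of_pos hα] at this
          simpa using this
        have a1 : q (s - α * x) * r (t - β * x ^ 2) * (1 + |s - α * x|) ≤
            R * ((1 + |s - α * x|) * q (s - α * x)) := by
          have := mul_le_mul_of_nonneg_left (hR (t - β * x ^ 2))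
            (mul_nonneg (hq0 (s - α * x)) (by positivity : 0 ≤ 1 + |s - α * x|))
          linarith
        have a2 : q (s - α * x) * r (t - β * x ^ 2) * (α * |x|) ≤
            α * Q * (|x| * r (t - β * x ^ 2)) := by
          have := mul_le_mul_of_nonneg_right (hQ (s - α * x))
            (mul_nonneg (hr0 (t - β * x ^ 2)) (by positivity : 0 ≤ α * |x|))
          linarith
        have a3 := mul_le_mul_of_nonneg_left hs
          (mul_nonneg (hq0 (s - α * x)) (hr0 (t - β * x ^ 2)))
        linarith
    _ = ENNReal.ofReal R * (∫⁻ x, ENNReal.ofReal ((1 + |s - α * x|) * q (s - α * x))) +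
          ENNReal.ofReal (α * Q) *
            ∫⁻ x, (ENNReal.ofReal |x| * ENNReal.ofReal (r (t - β * x ^ 2))) := by
        rw [lintegral_add_left (by fun_prop), lintegral_const_mul _ (by fun_prop),
          lintegral_const_mul _ (by fun_prop)]
    _ ≤ ENNReal.ofReal R * (ENNReal.ofReal D / ENNReal.ofReal α) +
          ENNReal.ofReal (α * Q) * (1 / ENNReal.ofReal β) := by gcongr
    _ = ENNReal.ofReal (R * D / α + α * Q / β) := by
        rw [ENNReal.ofReal_add (by positivity) (by positivity), mul_div_assoc R,
          ← mul_one_div (α * Q) β, ENNReal.ofReal_mul hR0,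
          ENNReal.ofReal_mul (p := α * Q) (by positivity),
          ENNReal.ofReal_div_of_pos hα, ENNReal.ofReal_div_of_pos hβ, ENNReal.ofReal_one]

end Substitution

/-! ### Real and complex Gaussian densities and moments -/

section Gaussian

lemma lintegral_complex {f : ℂ → ℝ≥0∞} (hf : Measurable f) :
    ∫⁻ z, f z = ∫⁻ x : ℝ, ∫⁻ y : ℝ, f ⟨x, y⟩ := by
  have h := Complex.volume_preserving_equiv_real_prod.symm.lintegral_comp hf
  rw [← h, Measure.volume_eq_prod, lintegral_prod]
  · rfl
  · exact (hf.comp Complex.measurableEquivRealProd.symm.measurable).aemeasurable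

lemma gaussianPDFReal_le (m : ℝ) (v : ℝ≥0) (x : ℝ) :
    gaussianPDFReal m v x ≤ (√(2 * Real.pi * v))⁻¹ := by
  rw [gaussianPDFReal]
  refine mul_le_of_le_one_right (by positivity) (Real.exp_le_one_iff.2 ?_)
  rw [neg_div]
  exact neg_nonpos.2 (by positivity)

lemma log_gaussianPDFReal (m : ℝ) {v : ℝ≥0} (hv : v ≠ 0) (x : ℝ) :
    Real.log (gaussianPDFReal m v x) =
      -(Real.log (2 * Real.pi * v) / 2) - (x - m) ^ 2 / (2 * v) := by
  have hv' : (0 : ℝ) < v := by positivity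
  rw [gaussianPDFReal, Real.log_mul (by positivity) (Real.exp_pos _).ne', Real.log_exp,
    Real.log_inv, Real.log_sqrt (by positivity)]
  ring

/-- The density of `CN(0, v)`. -/
noncomputable def complexGaussianPDF (v : ℝ≥0) (z : ℂ) : ℝ :=
  gaussianPDFReal 0 (v / 2) z.re * gaussianPDFReal 0 (v / 2) z.im

@[fun_prop]
lemma measurable_complexGaussianPDF (v : ℝ≥0) : Measurable (complexGaussianPDF v) := by
  unfold complexGaussianPDF
  have := measurable_gaussianPDFReal 0 (v / 2)
  fun_prop

lemma complexGaussianPDF_pos {v : ℝ≥0} (hv : v ≠ 0) (z : ℂ) : 0 < complexGaussianPDF v z :=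
  mul_pos (gaussianPDFReal_pos _ _ _ (by simpa using hv))
    (gaussianPDFReal_pos _ _ _ (by simpa using hv))

lemma complexGaussianPDF_le (v : ℝ≥0) (z : ℂ) :
    complexGaussianPDF v z ≤
      (√(2 * Real.pi * (v / 2 : ℝ≥0)))⁻¹ * (√(2 * Real.pi * (v / 2 : ℝ≥0)))⁻¹ :=
  mul_le_mul (gaussianPDFReal_le _ _ _) (gaussianPDFReal_le _ _ _) (gaussianPDFReal_nonneg _ _ _)
    (by positivity)

lemma complexGaussian_eq_withDensity {v : ℝ≥0} (hv : v ≠ 0) :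
    complexGaussian v = volume.withDensity fun z => ENNReal.ofReal (complexGaussianPDF v z) := by
  have hv2 : v / 2 ≠ 0 := by simpa using hv
  have hm := measurable_gaussianPDF 0 (v / 2)
  rw [complexGaussian, gaussianReal_of_var_ne_zero _ hv2, prod_withDensity hm hm,
    ← Measure.volume_eq_prod]
  ext s hs
  have e := Complex.volume_preserving_equiv_real_prod.symm
  have hs' := e.measurable hs
  rw [Measure.map_apply e.measurable hs, withDensity_apply _ hs', withDensity_apply _ hs,
    ← e.setLIntegral_comp_preimage hs (by fun_prop)]
  refine lintegral_congr fun x => ?_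
  simp only [gaussianPDF, complexGaussianPDF, Complex.measurableEquivRealProd_symm_apply]
  rw [ENNReal.ofReal_mul (gaussianPDFReal_nonneg _ _ _)]

instance (v : ℝ≥0) : IsProbabilityMeasure (complexGaussian v) :=
  Measure.isProbabilityMeasure_map Complex.measurableEquivRealProd.symm.measurable.aemeasurable

lemma hasLaw_re_complexGaussian (v : ℝ≥0) :
    HasLaw Complex.re (gaussianReal 0 (v / 2)) (complexGaussian v) where
  aemeasurable := Complex.measurable_re.aemeasurable
  map_eq := by
    rw [complexGaussian, Measure.map_map Complex.measurable_re (MeasurableEquiv.measurable _)]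
    exact Measure.fst_prod

lemma hasLaw_im_complexGaussian (v : ℝ≥0) :
    HasLaw Complex.im (gaussianReal 0 (v / 2)) (complexGaussian v) where
  aemeasurable := Complex.measurable_im.aemeasurable
  map_eq := by
    rw [complexGaussian, Measure.map_map Complex.measurable_im (MeasurableEquiv.measurable _)]
    exact Measure.snd_prod

variable {Ω : Type*} [MeasurableSpace Ω] {μ : Measure Ω} [IsProbabilityMeasure μ]

lemma integrable_pow_of_hasLaw_gaussianReal {X : Ω → ℝ} {m : ℝ} {v : ℝ≥0}
    (hX : HasLaw X (gaussianReal m v) μ) (n : ℕ) : Integrable (fun ω => X ω ^ n) μ := by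
  have h : MemLp X n μ := by
    have := memLp_id_gaussianReal (μ := m) (v := v) n
    rw [← hX.map_eq, memLp_map_measure_iff (by fun_prop) hX.aemeasurable] at this
    simpa using this
  exact (integrable_norm_iff (hX.aemeasurable.pow_const n).aestronglyMeasurable).1
    (by simpa using h.integrable_norm_pow')

lemma integrable_norm_pow_four_of_hasLaw_complexGaussian {X : Ω → ℂ} {v : ℝ≥0}
    (hX : HasLaw X (complexGaussian v) μ) : Integrable (fun ω => ‖X ω‖ ^ 4) μ := by
  have h1 := integrable_pow_of_hasLaw_gaussianReal ((hasLaw_re_complexGaussian v).comp hX) 4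
  have h2 := integrable_pow_of_hasLaw_gaussianReal ((hasLaw_im_complexGaussian v).comp hX) 4
  refine ((h1.add h2).const_mul 2).mono'
    ((hX.aemeasurable.norm.pow_const 4).aestronglyMeasurable) (ae_of_all _ fun ω => ?_)
  have e : ‖X ω‖ ^ 2 = (X ω).re ^ 2 + (X ω).im ^ 2 := by
    rw [← Complex.normSq_eq_norm_sq, Complex.normSq_apply]; ring
  have : ‖X ω‖ ^ 4 = ((X ω).re ^ 2 + (X ω).im ^ 2) ^ 2 := by rw [← e]; ring
  rw [Real.norm_of_nonneg (by positivity), this]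
  simp only [Pi.add_apply, Function.comp_apply]
  nlinarith [sq_nonneg ((X ω).re ^ 2 - (X ω).im ^ 2)]

/-- Near zero the Gaussian density is bounded and `log` is Lebesgue integrable; elsewhere `log |x| ≤
|x| - 1 ≤ x²`. -/
lemma integrable_log_gaussianReal {Ω : Type*} [MeasurableSpace Ω] {μ : Measure Ω}
    {X : Ω → ℝ} {v : ℝ≥0} (hv : v ≠ 0)
    (hX : HasLaw X (gaussianReal 0 v) μ) : Integrable (fun ω => Real.log |X ω|) μ := by
  have key : Integrable (fun x => Real.log |x|) (gaussianReal 0 v) := by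
    have hsq : Integrable (fun x : ℝ => x ^ 2) (gaussianReal 0 v) :=
      integrable_pow_of_hasLaw_gaussianReal HasLaw.id 2
    have hloc : Integrable ((Set.Ioc (-1) 1).indicator fun x : ℝ => Real.log x)
        (gaussianReal 0 v) := by
      have h0 : IntegrableOn Real.log (Set.Ioc (-1) 1) volume :=
        (intervalIntegrable_iff_integrableOn_Ioc_of_le (by norm_num)).1
          (intervalIntegral.intervalIntegrable_log' (a := -1) (b := 1))
      rw [gaussianReal_of_var_ne_zero _ hv]
      rw [integrable_withDensity_iff_integrable_smul' (by fun_prop)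
        (ae_of_all _ fun _ => gaussianPDF_lt_top)]
      have h1 := (integrable_indicator_iff measurableSet_Ioc).2 h0
      simp only [toReal_gaussianPDF, smul_eq_mul]
      refine h1.bdd_mul (c := (√(2 * Real.pi * v))⁻¹)
        (measurable_gaussianPDFReal 0 v).aestronglyMeasurable (ae_of_all _ fun x => ?_)
      rw [Real.norm_of_nonneg (gaussianPDFReal_nonneg _ _ _)]
      exact gaussianPDFReal_le _ _ _
    refine (hloc.norm.add hsq).mono'
      (Real.measurable_log.comp measurable_norm).aestronglyMeasurable (ae_of_all _ fun x => ?_)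
    simp only [Pi.add_apply, Real.log_abs]
    by_cases hx : x ∈ Set.Ioc (-1 : ℝ) 1
    · rw [Set.indicator_of_mem hx]
      nlinarith
    · rw [Set.indicator_of_notMem hx]
      have hx1 : 1 ≤ |x| := by
        by_contra! hlt
        exact hx ⟨(abs_lt.1 hlt).1, (abs_lt.1 hlt).2.le⟩
      rw [← Real.log_abs, Real.norm_of_nonneg (Real.log_nonneg hx1)]
      have := Real.log_le_sub_one_of_pos (zero_lt_one.trans_le hx1)
      simp only [norm_zero, zero_add]
      nlinarith [sq_abs x]
  rw [← hX.map_eq] at key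
  exact key.comp_aemeasurable hX.aemeasurable

lemma ae_ne_zero_of_hasLaw_gaussianReal {Ω : Type*} [MeasurableSpace Ω] {μ : Measure Ω}
    {X : Ω → ℝ} {v : ℝ≥0} (hv : v ≠ 0)
    (hX : HasLaw X (gaussianReal 0 v) μ) : ∀ᵐ ω ∂μ, X ω ≠ 0 := by
  have := nullSingletonClass_gaussianReal (μ := 0) hv
  have h : ∀ᵐ x ∂(gaussianReal 0 v), x ≠ 0 := by simp [ae_iff]
  rw [← hX.map_eq] at h
  exact ae_of_ae_map hX.aemeasurable h

lemma lintegral_abs_mul_gaussianPDFReal_lt_top {v : ℝ≥0} (hv : v ≠ 0) :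
    ∫⁻ x, ENNReal.ofReal ((1 + |x|) * gaussianPDFReal 0 v x) ≠ ∞ := by
  have h : Integrable (fun x : ℝ => 1 + |x|) (gaussianReal 0 v) :=
    (integrable_const 1).add (by
      have := integrable_pow_of_hasLaw_gaussianReal (μ := gaussianReal 0 v)
        (X := id) (m := 0) (v := v) HasLaw.id 1
      simpa using this.abs)
  rw [gaussianReal_of_var_ne_zero _ hv, integrable_withDensity_iff_integrable_smul' (by fun_prop)
        (ae_of_all _ fun _ => gaussianPDF_lt_top)] at h
  simp only [toReal_gaussianPDF, smul_eq_mul] at h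
  have h2 := (lintegral_ofReal_ne_top_iff_integrable h.1 (ae_of_all _ fun x =>
    mul_nonneg (gaussianPDFReal_nonneg _ _ _) (by positivity))).2 h
  simpa [mul_comm] using h2

end Gaussian

/-! ### The splitting channel and its trial output densities -/

section Channel

instance : (volume : Measure (ℂ × ℝ)).IsAddLeftInvariant :=
  inferInstanceAs ((volume : Measure ℂ).prod (volume : Measure ℝ)).IsAddLeftInvariant

/-- The density of the noise pair `(Z, N)`. -/
noncomputable def noisePDF (v₁ v₂ : ℝ≥0) (w : ℂ × ℝ) : ℝ :=
  complexGaussianPDF v₁ w.1 * gaussianPDFReal 0 v₂ w.2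

/-- The noiseless splitting channel. -/
noncomputable def splittingMap (a b : ℝ) (u : ℂ) : ℂ × ℝ := ((a : ℂ) * u, b * ‖u‖ ^ 2)

/-- The density of `(Y₁, Y₂)` with `Y₁ ∼ CN(0, s)` and `Y₂ ∼ N(c |Y₁|², t)` given `Y₁`. -/
noncomputable def paraboloidPDF (s t : ℝ≥0) (c : ℝ) (y : ℂ × ℝ) : ℝ :=
  complexGaussianPDF s y.1 * gaussianPDFReal (c * ‖y.1‖ ^ 2) t y.2

@[fun_prop]
lemma measurable_splittingMap (a b : ℝ) : Measurable (splittingMap a b) := by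
  unfold splittingMap; fun_prop

lemma measurable_paraboloidPDF (s t : ℝ≥0) (c : ℝ) : Measurable (paraboloidPDF s t c) := by
  have h := measurable_uncurry_gaussianPDFReal.comp
    (show Measurable fun y : ℂ × ℝ => (c * ‖y.1‖ ^ 2, t, y.2) by fun_prop)
  exact ((measurable_complexGaussianPDF s).comp measurable_fst).mul h

lemma noisePDF_eq_paraboloidPDF (v₁ v₂ : ℝ≥0) : noisePDF v₁ v₂ = paraboloidPDF v₁ v₂ 0 := by
  ext w; simp [noisePDF, paraboloidPDF]

@[fun_prop]
lemma measurable_noisePDF (v₁ v₂ : ℝ≥0) : Measurable (noisePDF v₁ v₂) :=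
  noisePDF_eq_paraboloidPDF v₁ v₂ ▸ measurable_paraboloidPDF v₁ v₂ 0

lemma paraboloidPDF_pos {s t : ℝ≥0} (hs : s ≠ 0) (ht : t ≠ 0) (c : ℝ) (y : ℂ × ℝ) :
    0 < paraboloidPDF s t c y :=
  mul_pos (complexGaussianPDF_pos hs _) (gaussianPDFReal_pos _ _ _ ht)

lemma noisePDF_pos {s t : ℝ≥0} (hs : s ≠ 0) (ht : t ≠ 0) (y : ℂ × ℝ) : 0 < noisePDF s t y :=
  mul_pos (complexGaussianPDF_pos hs _) (gaussianPDFReal_pos _ _ _ ht)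

lemma exists_complexGaussianPDF_le (v : ℝ≥0) : ∃ C, 0 < C ∧ ∀ z, complexGaussianPDF v z ≤ C :=
  ⟨_, lt_of_lt_of_le zero_lt_one (le_max_right _ 1), fun z =>
    (complexGaussianPDF_le v z).trans (le_max_left _ _)⟩

lemma exists_gaussianPDFReal_le (v : ℝ≥0) : ∃ C, 0 < C ∧ ∀ x, gaussianPDFReal 0 v x ≤ C :=
  ⟨_, lt_of_lt_of_le zero_lt_one (le_max_right _ 1), fun z =>
    (gaussianPDFReal_le 0 v z).trans (le_max_left _ _)⟩

lemma exists_noisePDF_le (v₁ v₂ : ℝ≥0) : ∃ C, ∀ w, noisePDF v₁ v₂ w ≤ C := by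
  obtain ⟨C, hC, h⟩ := exists_complexGaussianPDF_le v₁
  obtain ⟨D, _, h'⟩ := exists_gaussianPDFReal_le v₂
  exact ⟨C * D, fun w => mul_le_mul (h _) (h' _) (gaussianPDFReal_nonneg _ _ _) hC.le⟩

lemma lintegral_complexGaussianPDF {v : ℝ≥0} (hv : v ≠ 0) :
    ∫⁻ z, ENNReal.ofReal (complexGaussianPDF v z) = 1 := by
  have h : complexGaussian v Set.univ = 1 := measure_univ
  rwa [complexGaussian_eq_withDensity hv, withDensity_apply _ MeasurableSet.univ,
    Measure.restrict_univ] at h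

/-- Given the first coordinate, the second integrates to `1` whatever its mean is. -/
lemma lintegral_paraboloidPDF {s t : ℝ≥0} (hs : s ≠ 0) (ht : t ≠ 0) (c : ℝ) :
    ∫⁻ y, ENNReal.ofReal (paraboloidPDF s t c y) = 1 := by
  rw [Measure.volume_eq_prod, lintegral_prod _
    (measurable_paraboloidPDF s t c).ennreal_ofReal.aemeasurable]
  simp only [paraboloidPDF]
  rw [← lintegral_complexGaussianPDF hs]
  refine lintegral_congr fun z => ?_
  simp_rw [ENNReal.ofReal_mul (complexGaussianPDF_pos hs z).le]
  rw [lintegral_const_mul _ (measurable_gaussianPDFReal _ _).ennreal_ofReal,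
    lintegral_gaussianPDFReal_eq_one _ ht, mul_one]

lemma log_complexGaussianPDF {v : ℝ≥0} (hv : v ≠ 0) (z : ℂ) :
    Real.log (complexGaussianPDF v z) = -Real.log (Real.pi * v) - ‖z‖ ^ 2 / v := by
  have hv2 : v / 2 ≠ 0 := by simpa using hv
  have hv' : (0 : ℝ) < v := by positivity
  rw [complexGaussianPDF, Real.log_mul (gaussianPDFReal_pos _ _ _ hv2).ne'
    (gaussianPDFReal_pos _ _ _ hv2).ne', log_gaussianPDFReal 0 hv2, log_gaussianPDFReal 0 hv2,
    ← Complex.normSq_eq_norm_sq, Complex.normSq_apply]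
  have : 2 * Real.pi * ((v / 2 : ℝ≥0) : ℝ) = Real.pi * v := by push_cast; ring
  rw [this]
  push_cast
  field_simp
  ring

lemma log_paraboloidPDF {s t : ℝ≥0} (hs : s ≠ 0) (ht : t ≠ 0) (c : ℝ) (y : ℂ × ℝ) :
    -Real.log (paraboloidPDF s t c y) = Real.log (Real.pi * s) + ‖y.1‖ ^ 2 / s +
      Real.log (2 * Real.pi * t) / 2 + (y.2 - c * ‖y.1‖ ^ 2) ^ 2 / (2 * t) := by
  rw [paraboloidPDF, Real.log_mul (complexGaussianPDF_pos hs _).ne'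
    (gaussianPDFReal_pos _ _ _ ht).ne', log_complexGaussianPDF hs, log_gaussianPDFReal _ ht]
  ring

variable {Ω : Type*} [MeasurableSpace Ω]

/-- The distributional assumptions on the input `X` and the noises `Z` and `N`. -/
structure IsGaussianChannel (μ : Measure Ω) (X Z : Ω → ℂ) (N : Ω → ℝ) (v₁ v₂ : ℝ≥0) : Prop where
  ne_zero₁ : v₁ ≠ 0
  ne_zero₂ : v₂ ≠ 0
  input : HasLaw X (complexGaussian 1) μ
  noise₁ : HasLaw Z (complexGaussian v₁) μ
  noise₂ : HasLaw N (gaussianReal 0 v₂) μ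
  indep_noise : IndepFun Z N μ
  indep : IndepFun X (fun ω => (Z ω, N ω)) μ

/-- The mutual information, in nats, of the channel `u ↦ (a u + Z, b |u|² + N)` with input
`√P X`. -/
noncomputable def channelInfo (μ : Measure Ω) (X Z : Ω → ℂ) (N : Ω → ℝ) (a b P : ℝ) : ℝ≥0∞ :=
  InformationTheory.klDiv
    (μ.map fun ω => ((√P : ℂ) * X ω, splittingMap a b ((√P : ℂ) * X ω) + (Z ω, N ω)))
    ((μ.map fun ω => (√P : ℂ) * X ω).prod
      (μ.map fun ω => splittingMap a b ((√P : ℂ) * X ω) + (Z ω, N ω)))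

namespace IsGaussianChannel

variable {μ : Measure Ω} {X Z : Ω → ℂ} {N : Ω → ℝ} {v₁ v₂ : ℝ≥0}

lemma aemeasurable_input (hc : IsGaussianChannel μ X Z N v₁ v₂) (P : ℝ) :
    AEMeasurable (fun ω => (√P : ℂ) * X ω) μ :=
  hc.input.aemeasurable.const_mul _

lemma indepFun_input (hc : IsGaussianChannel μ X Z N v₁ v₂) (P : ℝ) :
    IndepFun (fun ω => (√P : ℂ) * X ω) (fun ω => (Z ω, N ω)) μ :=
  hc.indep.comp (φ := fun x => (√P : ℂ) * x) (by fun_prop) measurable_id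

variable [IsProbabilityMeasure μ]

lemma hasLaw_noise (hc : IsGaussianChannel μ X Z N v₁ v₂) :
    HasLaw (fun ω => (Z ω, N ω))
      (volume.withDensity fun w => ENNReal.ofReal (noisePDF v₁ v₂ w)) μ := by
  have h := hc.indep_noise.hasLaw_prod hc.noise₁ hc.noise₂
  rw [complexGaussian_eq_withDensity hc.ne_zero₁, gaussianReal_of_var_ne_zero _ hc.ne_zero₂,
    prod_withDensity (by fun_prop) (by fun_prop), ← Measure.volume_eq_prod] at h
  simp only [gaussianPDF] at h
  simp only [noisePDF, ENNReal.ofReal_mul (complexGaussianPDF_pos hc.ne_zero₁ _).le]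
  exact h

/-- A random variable that dominates the fluctuations of the information density. -/
noncomputable def envelope (X Z : Ω → ℂ) (N : Ω → ℝ) (ω : Ω) : ℝ :=
  1 + ‖X ω‖ ^ 4 + ‖Z ω‖ ^ 4 + N ω ^ 2

lemma integrable_envelope (hc : IsGaussianChannel μ X Z N v₁ v₂) :
    Integrable (envelope X Z N) μ :=
  (((integrable_const 1).add
    (integrable_norm_pow_four_of_hasLaw_complexGaussian hc.input)).add
    (integrable_norm_pow_four_of_hasLaw_complexGaussian hc.noise₁)).add
    (integrable_pow_of_hasLaw_gaussianReal hc.noise₂ 2)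

lemma integrable_log_noisePDF (hc : IsGaussianChannel μ X Z N v₁ v₂) :
    Integrable (fun ω => Real.log (noisePDF v₁ v₂ (Z ω, N ω))) μ := by
  have hz : (0 : ℝ) < v₁ := by have := hc.ne_zero₁; positivity
  have hn : (0 : ℝ) < v₂ := by have := hc.ne_zero₂; positivity
  have hi := hc.integrable_envelope
  have hm : AEStronglyMeasurable (fun ω => Real.log (noisePDF v₁ v₂ (Z ω, N ω))) μ :=
    (((Real.measurable_log.comp (measurable_noisePDF v₁ v₂)).comp_aemeasurable
      hc.hasLaw_noise.aemeasurable)).aestronglyMeasurable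
  refine ((integrable_const (|Real.log (Real.pi * v₁)| + |Real.log (2 * Real.pi * v₂) / 2|)).add
    (hi.mul_const (1 / (v₁ : ℝ) + 1 / (2 * v₂)))).mono' hm (ae_of_all _ fun ω => ?_)
  have e := log_paraboloidPDF hc.ne_zero₁ hc.ne_zero₂ 0 (Z ω, N ω)
  rw [← noisePDF_eq_paraboloidPDF] at e
  rw [← norm_neg, e, Real.norm_eq_abs]
  simp only [zero_mul, sub_zero, Pi.add_apply]
  have h1 : ‖Z ω‖ ^ 2 / v₁ ≤ envelope X Z N ω * (1 / (v₁ : ℝ)) := by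
    rw [mul_one_div]
    gcongr
    rw [envelope]
    nlinarith [sq_nonneg (‖Z ω‖ ^ 2 - 1), sq_nonneg (‖X ω‖ ^ 2), sq_nonneg (N ω),
      sq_nonneg (‖Z ω‖ ^ 2)]
  have h2 : N ω ^ 2 / (2 * v₂) ≤ envelope X Z N ω * (1 / (2 * (v₂ : ℝ))) := by
    rw [mul_one_div]
    gcongr
    rw [envelope]
    have : 0 ≤ ‖X ω‖ ^ 4 := by positivity
    have : 0 ≤ ‖Z ω‖ ^ 4 := by positivity
    linarith
  have h3 : 0 ≤ ‖Z ω‖ ^ 2 / v₁ := by positivity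
  have h4 : 0 ≤ N ω ^ 2 / (2 * v₂) := by positivity
  rw [abs_le]
  constructor <;>
  linarith [le_abs_self (Real.log (Real.pi * v₁)), neg_abs_le (Real.log (Real.pi * v₁)),
      le_abs_self (Real.log (2 * Real.pi * v₂) / 2), neg_abs_le (Real.log (2 * Real.pi * v₂) / 2)]

/-- Gibbs' bound with `paraboloidPDF s t c` as trial density. It reduces an upper bound to a
deterministic inequality in `x`, `z`, `n`, with `s`, `t`, `c` free to fit the regime. -/
lemma channelInfo_le (hc : IsGaussianChannel μ X Z N v₁ v₂) {a b P : ℝ} {s t : ℝ} (hs : 0 < s)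
    (ht : 0 < t) (c : ℝ) {A c₁ : ℝ}
    (h : ∀ x z n, Real.log (Real.pi * s) + ‖(a : ℂ) * ((√P : ℂ) * x) + z‖ ^ 2 / s +
      Real.log (2 * Real.pi * t) / 2 + (b * ‖(√P : ℂ) * x‖ ^ 2 + n -
        c * ‖(a : ℂ) * ((√P : ℂ) * x) + z‖ ^ 2) ^ 2 / (2 * t) ≤
      A + c₁ * (1 + ‖x‖ ^ 4 + ‖z‖ ^ 4 + n ^ 2)) :
    channelInfo μ X Z N a b P ≤ ENNReal.ofReal (∫ ω, Real.log (noisePDF v₁ v₂ (Z ω, N ω)) ∂μ + A +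
      ∫ ω, c₁ * envelope X Z N ω ∂μ) := by
  obtain ⟨C, hC⟩ := exists_noisePDF_le v₁ v₂
  lift s to ℝ≥0 using hs.le
  lift t to ℝ≥0 using ht.le
  have hs' : s ≠ 0 := by rintro rfl; simp at hs
  have ht' : t ≠ 0 := by rintro rfl; simp at ht
  refine klDiv_additive_noise_le (hc.aemeasurable_input P) hc.hasLaw_noise
    (hc.indepFun_input P) (measurable_splittingMap a b) (measurable_noisePDF v₁ v₂)
    (noisePDF_pos hc.ne_zero₁ hc.ne_zero₂) hC hc.integrable_log_noisePDF
    (measurable_paraboloidPDF s t c) (paraboloidPDF_pos hs' ht' c)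
    (lintegral_paraboloidPDF hs' ht' c).le (hc.integrable_envelope.const_mul c₁) fun ω => ?_
  rw [log_paraboloidPDF hs' ht']
  exact h (X ω) (Z ω) (N ω)

end IsGaussianChannel

end Channel

/-! ### Upper bounds on the information -/

section UpperBound

lemma norm_sqrt_mul_sq {P : ℝ} (hP : 0 ≤ P) (x : ℂ) : ‖(√P : ℂ) * x‖ ^ 2 = P * ‖x‖ ^ 2 := by
  rw [norm_mul, mul_pow, Complex.norm_real, Real.norm_eq_abs, sq_abs, Real.sq_sqrt hP]

lemma abs_norm_mul_add_sub_le {a : ℝ} (ha : 0 ≤ a) (u z : ℂ) :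
    |‖(a : ℂ) * u + z‖ - a * ‖u‖| ≤ ‖z‖ := by
  have h := abs_norm_sub_norm_le ((a : ℂ) * u + z) ((a : ℂ) * u)
  rwa [add_sub_cancel_left, norm_mul, Complex.norm_real, Real.norm_of_nonneg ha] at h

lemma norm_mul_add_sq_le {a P : ℝ} (hP : 0 ≤ P) (x z : ℂ) :
    ‖(a : ℂ) * ((√P : ℂ) * x) + z‖ ^ 2 ≤ 2 * (a ^ 2 * P) * ‖x‖ ^ 2 + 2 * ‖z‖ ^ 2 := by
  have h := norm_add_le ((a : ℂ) * ((√P : ℂ) * x)) z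
  have e : ‖(a : ℂ) * ((√P : ℂ) * x)‖ ^ 2 = a ^ 2 * P * ‖x‖ ^ 2 := by
    rw [norm_mul, mul_pow, norm_sqrt_mul_sq hP, Complex.norm_real, Real.norm_eq_abs, sq_abs]
    ring
  have := pow_le_pow_left₀ (norm_nonneg _) h 2
  nlinarith [sq_nonneg (‖(a : ℂ) * ((√P : ℂ) * x)‖ - ‖z‖)]

/-- Deviation of `|a u + z|²` from `a² |u|²`. -/
lemma sq_norm_mul_add_sub_le {a : ℝ} (ha : 0 ≤ a) (u z : ℂ) :
    (‖(a : ℂ) * u + z‖ ^ 2 - a ^ 2 * ‖u‖ ^ 2) ^ 2 ≤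
      8 * a ^ 2 * ‖u‖ ^ 2 * ‖z‖ ^ 2 + 2 * ‖z‖ ^ 4 := by
  have h := abs_norm_mul_add_sub_le ha u z
  set y := ‖(a : ℂ) * u + z‖
  have hz := norm_nonneg z
  have hu := mul_nonneg ha (norm_nonneg u)
  have e : y ^ 2 - a ^ 2 * ‖u‖ ^ 2 = (y - a * ‖u‖) * ((y - a * ‖u‖) + 2 * (a * ‖u‖)) := by ring
  have h1 : |y ^ 2 - a ^ 2 * ‖u‖ ^ 2| ≤ ‖z‖ * (‖z‖ + 2 * (a * ‖u‖)) := by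
    rw [e, abs_mul]
    refine mul_le_mul h ((abs_add_le _ _).trans ?_) (abs_nonneg _) hz
    rw [abs_of_nonneg (mul_nonneg zero_le_two hu)]
    linarith
  rw [← sq_abs]
  have h2 := pow_le_pow_left₀ (abs_nonneg _) h1 2
  refine h2.trans ?_
  -- With `r = a‖u‖`, this is `2‖z‖² + 8r² - (‖z‖ + 2r)² = (‖z‖ - 2r)²`, multiplied by `‖z‖²`.
  nlinarith [mul_nonneg (sq_nonneg ‖z‖) (sq_nonneg (‖z‖ - 2 * (a * ‖u‖)))]

namespace IsGaussianChannel

variable {Ω : Type*} [MeasurableSpace Ω] {μ : Measure Ω} [IsProbabilityMeasure μ]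
  {X Z : Ω → ℂ} {N : Ω → ℝ} {v₁ v₂ : ℝ≥0}

lemma channelInfo_le_of_one_le (hc : IsGaussianChannel μ X Z N v₁ v₂) {a b P B : ℝ} (ha : 0 ≤ a)
    (haB : a ^ 2 ≤ B) (hbB : b ^ 2 ≤ B) (hB : 1 ≤ B) (hP : 1 ≤ P) (haP : 1 ≤ a ^ 2 * P) :
    channelInfo μ X Z N a b P ≤ ENNReal.ofReal (∫ ω, Real.log (noisePDF v₁ v₂ (Z ω, N ω)) ∂μ +
      (3 / 2 * Real.log P + (Real.log Real.pi + Real.log (2 * Real.pi) / 2 + Real.log B / 2)) +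
      ∫ ω, 14 * B * envelope X Z N ω ∂μ) := by
  have hP0 : 0 < P := by linarith
  have ha2 : 0 < a ^ 2 := by
    by_contra! h
    nlinarith
  have ha' : a ≠ 0 := by rintro rfl; simp at ha2
  -- `a²P` is the power of `Y₁`. The residual `Y₂ - (b/a²)|Y₁|²` has leading part of order `(b/a²) ·
  -- a√P`, hence `t` of order `P / a²`. In `log s + log t / 2` only `log a² / 2` survives besides
  -- `3/2 log P`, and it stays bounded above as `a` decreases.
  refine hc.channelInfo_le (s := a ^ 2 * P) (t := P / a ^ 2) (by positivity) (by positivity)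
    (b / a ^ 2) fun x z n => ?_
  have h1 := norm_mul_add_sq_le (a := a) hP0.le x z
  have h2 := sq_norm_mul_add_sub_le ha ((√P : ℂ) * x) z
  rw [norm_sqrt_mul_sq hP0.le] at h2 ⊢
  set y := ‖(a : ℂ) * ((√P : ℂ) * x) + z‖ ^ 2
  have hx := norm_nonneg x
  have hz := norm_nonneg z
  set p := ‖x‖
  set q := ‖z‖
  have hlog : Real.log (Real.pi * (a ^ 2 * P)) + Real.log (2 * Real.pi * (P / a ^ 2)) / 2 ≤
      3 / 2 * Real.log P +
        (Real.log Real.pi + Real.log (2 * Real.pi) / 2 + Real.log B / 2) := by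
    have := Real.log_le_log ha2 haB
    rw [Real.log_mul (by positivity) (by positivity), Real.log_mul (by positivity) (by positivity),
      Real.log_mul (x := 2 * Real.pi) (by positivity) (by positivity),
      Real.log_div (by positivity) (by positivity)]
    linarith
  have h3 : y / (a ^ 2 * P) ≤ 2 * p ^ 2 + 2 * q ^ 2 := by
    rw [div_le_iff₀ (by positivity)]
    nlinarith [mul_le_mul_of_nonneg_left haP (sq_nonneg q)]
  have h4 : (b * (P * p ^ 2) + n - b / a ^ 2 * y) ^ 2 / (2 * (P / a ^ 2)) ≤
      B * n ^ 2 + 8 * B * (p ^ 2 * q ^ 2) + 2 * B * q ^ 4 := by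
    have e : b * (P * p ^ 2) + n - b / a ^ 2 * y = n - b / a ^ 2 * (y - a ^ 2 * (P * p ^ 2)) := by
      field_simp; ring
    rw [e, div_le_iff₀ (by positivity)]
    set w := y - a ^ 2 * (P * p ^ 2)
    have h5 : (n - b / a ^ 2 * w) ^ 2 ≤ 2 * n ^ 2 + 2 * ((b / a ^ 2) ^ 2 * w ^ 2) := by
      nlinarith [sq_nonneg (n + b / a ^ 2 * w)]
    have h6 : (b / a ^ 2) ^ 2 * w ^ 2 ≤ (b / a ^ 2) ^ 2 *
        (8 * a ^ 2 * (P * p ^ 2) * q ^ 2 + 2 * q ^ 4) := by gcongr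
    have h7 : (b / a ^ 2) ^ 2 * (8 * a ^ 2 * (P * p ^ 2) * q ^ 2 + 2 * q ^ 4) =
        b ^ 2 * (8 * (p ^ 2 * q ^ 2) + 2 * q ^ 4 * (1 / (a ^ 2 * P))) * (P / a ^ 2) := by
      field_simp
    -- `1 ≤ a²P` controls the contribution of `|z|⁴` to the residual.
    have h8 : 1 / (a ^ 2 * P) ≤ 1 := by rw [div_le_one (by positivity)]; exact haP
    have h9 : b ^ 2 * (8 * (p ^ 2 * q ^ 2) + 2 * q ^ 4 * (1 / (a ^ 2 * P))) * (P / a ^ 2) ≤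
        B * (8 * (p ^ 2 * q ^ 2) + 2 * q ^ 4 * 1) * (P / a ^ 2) := by gcongr
    have h10 : n ^ 2 * 1 ≤ n ^ 2 * (B * (P / a ^ 2)) := by
      gcongr
      rw [← mul_div_assoc, le_div_iff₀ ha2]
      nlinarith
    linarith
  have h11 : 0 ≤ (p ^ 2 - 1) ^ 2 := sq_nonneg _
  have h12 : 0 ≤ (q ^ 2 - 1) ^ 2 := sq_nonneg _
  have h13 : B * (p ^ 2 * q ^ 2) ≤ B * ((p ^ 4 + q ^ 4) / 2) := by
    gcongr
    nlinarith [sq_nonneg (p ^ 2 - q ^ 2)]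
  have h14 : 1 * (2 * p ^ 2 + 2 * q ^ 2) ≤ B * (2 + p ^ 4 + q ^ 4) := by
    refine mul_le_mul hB ?_ (by positivity) (by linarith)
    nlinarith
  have h15 : 0 ≤ B * p ^ 4 := by positivity
  have h16 : 0 ≤ B * q ^ 4 := by positivity
  have h17 : 0 ≤ B * n ^ 2 := by positivity
  linarith

lemma channelInfo_le_of_le_one (hc : IsGaussianChannel μ X Z N v₁ v₂) {a b P B : ℝ}
    (hbB : b ^ 2 ≤ B) (hB : 1 ≤ B) (hP : 1 ≤ P) (haP : a ^ 2 * P ≤ 1) :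
    channelInfo μ X Z N a b P ≤ ENNReal.ofReal (∫ ω, Real.log (noisePDF v₁ v₂ (Z ω, N ω)) ∂μ +
      (Real.log P + (Real.log Real.pi + Real.log (2 * Real.pi) / 2 + Real.log B / 2)) +
      ∫ ω, 14 * B * envelope X Z N ω ∂μ) := by
  have hP0 : 0 < P := by linarith
  -- Here `Y₁` stays of order one and carries no growth, while `Y₂` is at most of order `P`; no
  -- correlation is needed.
  refine hc.channelInfo_le (s := 1) (t := P ^ 2) (by positivity) (by positivity)
    0 fun x z n => ?_
  have h1 := norm_mul_add_sq_le (a := a) hP0.le x z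
  rw [norm_sqrt_mul_sq hP0.le]
  set y := ‖(a : ℂ) * ((√P : ℂ) * x) + z‖ ^ 2
  set p := ‖x‖
  set q := ‖z‖
  have hlogB : 0 ≤ Real.log B := Real.log_nonneg hB
  have hlog : Real.log (Real.pi * 1) + Real.log (2 * Real.pi * P ^ 2) / 2 =
      Real.log P + (Real.log Real.pi + Real.log (2 * Real.pi) / 2) := by
    rw [mul_one, Real.log_mul (by positivity) (by positivity), Real.log_pow]
    push_cast
    ring
  have h2 : a ^ 2 * P * p ^ 2 ≤ 1 * p ^ 2 := by gcongr
  have h3 : (b * (P * p ^ 2) + n - 0 * y) ^ 2 / (2 * P ^ 2) ≤ B * p ^ 4 + n ^ 2 := by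
    rw [div_le_iff₀ (by positivity)]
    have h4 : (b * (P * p ^ 2) + n - 0 * y) ^ 2 ≤ 2 * (b ^ 2 * (P ^ 2 * p ^ 4)) + 2 * n ^ 2 := by
      nlinarith [sq_nonneg (b * (P * p ^ 2) - n)]
    have h5 : b ^ 2 * (P ^ 2 * p ^ 4) ≤ B * (P ^ 2 * p ^ 4) := by gcongr
    have h6 : n ^ 2 * 1 ≤ n ^ 2 * P ^ 2 := by
      gcongr
      exact one_le_pow₀ hP
    linarith
  have h11 : 0 ≤ (p ^ 2 - 1) ^ 2 := sq_nonneg _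
  have h12 : 0 ≤ (q ^ 2 - 1) ^ 2 := sq_nonneg _
  have h14 : 1 * (2 * p ^ 2 + 2 * q ^ 2) ≤ B * (2 + p ^ 4 + q ^ 4) := by
    refine mul_le_mul hB ?_ (by positivity) (by linarith)
    nlinarith
  have h15 : 0 ≤ B * p ^ 4 := by positivity
  have h16 : 0 ≤ B * q ^ 4 := by positivity
  have h17 : 1 * n ^ 2 ≤ B * n ^ 2 := by gcongr
  rw [div_one]
  linarith [sq_nonneg n]

lemma channelInfo_zero_right_le (hc : IsGaussianChannel μ X Z N v₁ v₂) {a P B : ℝ}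
    (haB : a ^ 2 ≤ B) (hB : 1 ≤ B) (hP : 1 ≤ P) :
    channelInfo μ X Z N a 0 P ≤ ENNReal.ofReal (∫ ω, Real.log (noisePDF v₁ v₂ (Z ω, N ω)) ∂μ +
      (Real.log P + (Real.log Real.pi + Real.log (2 * Real.pi) / 2 + Real.log B / 2)) +
      ∫ ω, 14 * B * envelope X Z N ω ∂μ) := by
  have hP0 : 0 < P := by linarith
  -- `Y₂` is pure noise. Taking `s = P` instead of `a²P` lets `a` be arbitrarily small, or zero.
  refine hc.channelInfo_le (s := P) (t := 1) (by positivity) (by positivity)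
    0 fun x z n => ?_
  have h1 := norm_mul_add_sq_le (a := a) hP0.le x z
  rw [norm_sqrt_mul_sq hP0.le]
  set y := ‖(a : ℂ) * ((√P : ℂ) * x) + z‖ ^ 2
  set p := ‖x‖
  set q := ‖z‖
  have hlogB : 0 ≤ Real.log B := Real.log_nonneg hB
  have hlog : Real.log (Real.pi * P) + Real.log (2 * Real.pi * 1) / 2 =
      Real.log P + (Real.log Real.pi + Real.log (2 * Real.pi) / 2) := by
    rw [mul_one, Real.log_mul (by positivity) (by positivity)]
    ring
  have h3 : y / P ≤ B * (2 * p ^ 2 + 2 * q ^ 2) := by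
    rw [div_le_iff₀ hP0]
    have h5 : a ^ 2 * P * p ^ 2 ≤ B * P * p ^ 2 := by gcongr
    have h6 : 1 * 1 * q ^ 2 ≤ B * P * q ^ 2 := by gcongr
    linarith
  have h11 : 0 ≤ B * (p ^ 2 - 1) ^ 2 := by positivity
  have h12 : 0 ≤ B * (q ^ 2 - 1) ^ 2 := by positivity
  have h15 : 0 ≤ B * p ^ 4 := by positivity
  have h16 : 0 ≤ B * q ^ 4 := by positivity
  have h17 : 1 * n ^ 2 ≤ B * n ^ 2 := by gcongr
  have h18 : (0 * (P * p ^ 2) + n - 0 * y) ^ 2 / (2 * 1) = n ^ 2 / 2 := by ring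
  rw [h18]
  linarith [sq_nonneg n]

/-- Upper bounds on the mutual information, uniform in bounded channel gains: the pre-log factor is
at most `3 / 2`, and at most `1` if one of the two outputs does not depend on the input. -/
lemma exists_channelInfo_le (hc : IsGaussianChannel μ X Z N v₁ v₂) (B : ℝ) :
    ∃ C : ℝ, ∀ a b P : ℝ, 0 ≤ a → a ^ 2 ≤ B → b ^ 2 ≤ B → 1 ≤ P →
      channelInfo μ X Z N a b P ≤ ENNReal.ofReal (3 / 2 * Real.log P + C) ∧
      (a = 0 ∨ b = 0 → channelInfo μ X Z N a b P ≤ ENNReal.ofReal (Real.log P + C)) := by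
  refine ⟨∫ ω, Real.log (noisePDF v₁ v₂ (Z ω, N ω)) ∂μ +
      (Real.log Real.pi + Real.log (2 * Real.pi) / 2 + Real.log (max B 1) / 2) +
      ∫ ω, 14 * max B 1 * envelope X Z N ω ∂μ, fun a b P ha haB hbB hP => ⟨?_, ?_⟩⟩
  -- The threshold depends on `a` and `P` jointly, so the constant stays uniform down to `a = 0`.
  · rcases le_total 1 (a ^ 2 * P) with h | h
    · refine (hc.channelInfo_le_of_one_le ha (haB.trans (le_max_left B 1))
        (hbB.trans (le_max_left B 1)) (le_max_right B 1) hP h).trans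
        (ENNReal.ofReal_le_ofReal (le_of_eq ?_))
      ring
    · refine (hc.channelInfo_le_of_le_one
        (hbB.trans (le_max_left B 1)) (le_max_right B 1) hP h).trans
        (ENNReal.ofReal_le_ofReal ?_)
      linarith [Real.log_nonneg hP]
  · rintro (rfl | rfl)
    · refine (hc.channelInfo_le_of_le_one
        (hbB.trans (le_max_left B 1)) (le_max_right B 1) hP (by simp)).trans
        (ENNReal.ofReal_le_ofReal (le_of_eq ?_))
      ring
    · refine (hc.channelInfo_zero_right_le
        (haB.trans (le_max_left B 1)) (le_max_right B 1) hP).trans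
        (ENNReal.ofReal_le_ofReal (le_of_eq ?_))
      ring

end IsGaussianChannel

end UpperBound

/-! ### Pointwise bounds on the output density and lower bounds on the information -/

section LowerBound

lemma lintegral_gaussianPDFReal_sub_mul_le {v : ℝ≥0} (hv : v ≠ 0) {α : ℝ} (hα : 0 < α) (s : ℝ) :
    ∫⁻ x, ENNReal.ofReal (gaussianPDFReal 0 v (s - α * x)) ≤ ENNReal.ofReal (1 / α) := by
  have h := mul_lintegral_comp_sub_mul_le hα s
    (measurable_gaussianPDFReal 0 v).ennreal_ofReal
  rw [lintegral_gaussianPDFReal_eq_one 0 hv] at h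
  rw [ENNReal.ofReal_div_of_pos hα, ENNReal.ofReal_one,
    ENNReal.le_div_iff_mul_le (by simp [hα]) (by simp), mul_comm]
  exact h

/-- Density of the noise at the distance of the output `v` from the noiseless output. -/
lemma noisePDF_sub_splittingMap {v₁ v₂ : ℝ≥0} {P : ℝ} (hP : 0 ≤ P) (a b : ℝ) (v : ℂ × ℝ)
    (x y : ℝ) :
    noisePDF v₁ v₂ (v - splittingMap a b ((√P : ℂ) * (⟨x, y⟩ : ℂ))) =
      gaussianPDFReal 0 (v₁ / 2) (v.1.re - a * √P * x) *
        (gaussianPDFReal 0 (v₁ / 2) (v.1.im - a * √P * y) *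
          gaussianPDFReal 0 v₂ (v.2 - b * P * x ^ 2 - b * P * y ^ 2)) := by
  have e : ‖(⟨x, y⟩ : ℂ)‖ ^ 2 = x ^ 2 + y ^ 2 := by
    rw [← Complex.normSq_eq_norm_sq, Complex.normSq_apply]; ring
  simp only [noisePDF, complexGaussianPDF, splittingMap, Prod.fst_sub, Prod.snd_sub,
    norm_sqrt_mul_sq hP, e, Complex.sub_re, Complex.sub_im, Complex.mul_re, Complex.mul_im,
    Complex.ofReal_re, Complex.ofReal_im]
  rw [mul_assoc]
  congr 2
  · ring
  · congr 1; ring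
  · congr 1; ring

/-- Once the factor of `N` is bounded by `R`, each real coordinate integrates to at most `1 /
(a√P)`. -/
lemma lintegral_noisePDF_zero_right_le {v₁ v₂ : ℝ≥0} (hv₁ : v₁ ≠ 0) {R : ℝ}
    (hR : ∀ x, gaussianPDFReal 0 v₂ x ≤ R) {a P : ℝ} (ha : 0 < a) (hP : 0 < P) (v : ℂ × ℝ) :
    ∫⁻ z : ℂ, ENNReal.ofReal (noisePDF v₁ v₂ (v - splittingMap a 0 ((√P : ℂ) * z))) ≤
      ENNReal.ofReal (R / a ^ 2 / P) := by
  have hv : v₁ / 2 ≠ 0 := by simpa using hv₁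
  have hα : 0 < a * √P := by positivity
  have hR0 : 0 ≤ R := (gaussianPDFReal_nonneg _ _ 0).trans (hR 0)
  have hq := measurable_gaussianPDFReal 0 (v₁ / 2)
  rw [lintegral_complex (by fun_prop)]
  simp_rw [noisePDF_sub_splittingMap hP.le]
  calc _ ≤ ∫⁻ x : ℝ, ENNReal.ofReal (gaussianPDFReal 0 (v₁ / 2) (v.1.re - a * √P * x)) *
        ∫⁻ y : ℝ, ENNReal.ofReal (gaussianPDFReal 0 (v₁ / 2) (v.1.im - a * √P * y)) *
          ENNReal.ofReal R := by
        refine lintegral_mono fun x => ?_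
        rw [← lintegral_const_mul _ (by fun_prop)]
        refine lintegral_mono fun y => ?_
        rw [ENNReal.ofReal_mul (gaussianPDFReal_nonneg _ _ _),
          ENNReal.ofReal_mul (gaussianPDFReal_nonneg _ _ _)]
        gcongr
        exact hR _
    _ ≤ ∫⁻ x : ℝ, ENNReal.ofReal (gaussianPDFReal 0 (v₁ / 2) (v.1.re - a * √P * x)) *
          (ENNReal.ofReal (1 / (a * √P)) * ENNReal.ofReal R) := by
        gcongr with x
        rw [lintegral_mul_const _ (by fun_prop)]
        gcongr
        exact lintegral_gaussianPDFReal_sub_mul_le hv hα _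
    _ ≤ ENNReal.ofReal (1 / (a * √P)) * (ENNReal.ofReal (1 / (a * √P)) * ENNReal.ofReal R) := by
        rw [lintegral_mul_const _ (by fun_prop)]
        gcongr
        exact lintegral_gaussianPDFReal_sub_mul_le hv hα _
    _ = ENNReal.ofReal (R / a ^ 2 / P) := by
        rw [← ENNReal.ofReal_mul (by positivity), ← ENNReal.ofReal_mul (by positivity)]
        congr 1
        have : √P ^ 2 = P := Real.sq_sqrt hP.le
        field_simp
        rw [this, mul_comm]

/-- For fixed real part, `mul_lintegral_quadratic_le` with `α = a√P` and `β = bP` bounds the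
integral over the imaginary part, uniformly in the shift of the quadratic term. That bound and the
remaining Gaussian integral are each of order `1/√P`. -/
lemma mul_lintegral_noisePDF_le {v₁ v₂ : ℝ≥0} (hv₁ : v₁ ≠ 0) (hv₂ : v₂ ≠ 0) {Q R D : ℝ}
    (hD0 : 0 ≤ D) (hQ : ∀ x, gaussianPDFReal 0 (v₁ / 2) x ≤ Q)
    (hR : ∀ x, gaussianPDFReal 0 v₂ x ≤ R)
    (hD : ∫⁻ x, ENNReal.ofReal ((1 + |x|) * gaussianPDFReal 0 (v₁ / 2) x) ≤ ENNReal.ofReal D)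
    {a b P : ℝ} (ha : 0 < a) (hb : 0 < b) (hP : 0 < P) (v : ℂ × ℝ) :
    ENNReal.ofReal (1 + |v.1.im|) *
      ∫⁻ z : ℂ, ENNReal.ofReal (noisePDF v₁ v₂ (v - splittingMap a b ((√P : ℂ) * z))) ≤
      ENNReal.ofReal ((R * D / a + a * Q / b) / a / P) := by
  have hv : v₁ / 2 ≠ 0 := by simpa using hv₁
  have hα : 0 < a * √P := by positivity
  have hQ0 : 0 ≤ Q := (gaussianPDFReal_nonneg _ _ 0).trans (hQ 0)
  have hR0 : 0 ≤ R := (gaussianPDFReal_nonneg _ _ 0).trans (hR 0)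
  have hq := measurable_gaussianPDFReal 0 (v₁ / 2)
  have hr := measurable_gaussianPDFReal 0 v₂
  rw [lintegral_complex (by fun_prop)]
  simp_rw [noisePDF_sub_splittingMap hP.le,
    ENNReal.ofReal_mul (gaussianPDFReal_nonneg 0 (v₁ / 2) _)]
  have hm : Measurable fun x : ℝ => ∫⁻ y : ℝ,
      ENNReal.ofReal (gaussianPDFReal 0 (v₁ / 2) (v.1.re - a * √P * x)) *
        (ENNReal.ofReal (gaussianPDFReal 0 (v₁ / 2) (v.1.im - a * √P * y)) *
          ENNReal.ofReal (gaussianPDFReal 0 v₂ (v.2 - b * P * x ^ 2 - b * P * y ^ 2))) := by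
    have : Measurable fun x : ℝ × ℝ =>
      ENNReal.ofReal (gaussianPDFReal 0 (v₁ / 2) (v.1.re - a * √P * x.1)) *
        (ENNReal.ofReal (gaussianPDFReal 0 (v₁ / 2) (v.1.im - a * √P * x.2)) *
          ENNReal.ofReal (gaussianPDFReal 0 v₂ (v.2 - b * P * x.1 ^ 2 - b * P * x.2 ^ 2))) := by
      fun_prop
    exact this.lintegral_prod_right'
  rw [← lintegral_const_mul _ hm]
  calc _ ≤ ∫⁻ x : ℝ, ENNReal.ofReal (gaussianPDFReal 0 (v₁ / 2) (v.1.re - a * √P * x)) *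
        ENNReal.ofReal (R * D / (a * √P) + a * √P * Q / (b * P)) := by
        refine lintegral_mono fun x => ?_
        dsimp only
        rw [lintegral_const_mul _ (by fun_prop), mul_left_comm]
        gcongr
        simp_rw [← ENNReal.ofReal_mul (gaussianPDFReal_nonneg 0 (v₁ / 2) _)]
        exact mul_lintegral_quadratic_le hq hr (gaussianPDFReal_nonneg _ _)
          (gaussianPDFReal_nonneg _ _) hD0 hQ hR hD (lintegral_gaussianPDFReal_eq_one 0 hv₂).le hα
          (by positivity) _ _
    _ ≤ ENNReal.ofReal (1 / (a * √P)) *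
          ENNReal.ofReal (R * D / (a * √P) + a * √P * Q / (b * P)) := by
        rw [lintegral_mul_const _ (by fun_prop)]
        gcongr
        exact lintegral_gaussianPDFReal_sub_mul_le hv hα _
    _ = ENNReal.ofReal ((R * D / a + a * Q / b) / a / P) := by
        rw [← ENNReal.ofReal_mul (by positivity)]
        congr 1
        have : √P ^ 2 = P := Real.sq_sqrt hP.le
        have hs : √P ≠ 0 := by positivity
        rw [← this, Real.sqrt_sq (Real.sqrt_nonneg P)]
        field_simp

namespace IsGaussianChannel

variable {Ω : Type*} [MeasurableSpace Ω] {μ : Measure Ω}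
  {X Z : Ω → ℂ} {N : Ω → ℝ} {v₁ v₂ : ℝ≥0}

/-- The bounded density of `X` is replaced by its bound. Integrating over `X` rather than `√P X`
keeps this bound free of `P`. -/
lemma outputDensity_le_lintegral (hc : IsGaussianChannel μ X Z N v₁ v₂) {C : ℝ}
    (hC : ∀ z, complexGaussianPDF 1 z ≤ C) (a b P : ℝ) (v : ℂ × ℝ) :
    outputDensity (μ.map fun ω => (√P : ℂ) * X ω) (splittingMap a b) (noisePDF v₁ v₂) v ≤
      ENNReal.ofReal C *
      ∫⁻ z : ℂ, ENNReal.ofReal (noisePDF v₁ v₂ (v - splittingMap a b ((√P : ℂ) * z))) := by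
  have e : μ.map (fun ω => (√P : ℂ) * X ω) =
      (complexGaussian 1).map fun x => (√P : ℂ) * x := by
    rw [← hc.input.map_eq, AEMeasurable.map_map_of_aemeasurable (by fun_prop) hc.input.aemeasurable]
    rfl
  rw [outputDensity, e, lintegral_map (by fun_prop) (by fun_prop),
    complexGaussian_eq_withDensity one_ne_zero,
    lintegral_withDensity_eq_lintegral_mul _ (by fun_prop) (by fun_prop),
    ← lintegral_const_mul _ (by fun_prop)]
  refine lintegral_mono fun z => ?_
  simp only [Pi.mul_apply]
  gcongr
  exact hC z

variable [IsProbabilityMeasure μ]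

/-- The coherent receiver has pre-log factor at least `1`. -/
lemma exists_le_channelInfo_zero_right (hc : IsGaussianChannel μ X Z N v₁ v₂) {a : ℝ}
    (ha : 0 < a) :
    ∃ C : ℝ, ∀ P : ℝ, 0 < P → ENNReal.ofReal (Real.log P - C) ≤ channelInfo μ X Z N a 0 P := by
  obtain ⟨B, hB0, hB⟩ := exists_complexGaussianPDF_le 1
  obtain ⟨R, hR0, hR⟩ := exists_gaussianPDFReal_le v₂
  obtain ⟨M, hM⟩ := exists_noisePDF_le v₁ v₂
  refine ⟨Real.log (B * (R / a ^ 2)) - ∫ ω, Real.log (noisePDF v₁ v₂ (Z ω, N ω)) ∂μ,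
    fun P hP => ?_⟩
  have h := le_klDiv_additive_noise (hc.aemeasurable_input P) hc.hasLaw_noise
    (hc.indepFun_input P) (measurable_splittingMap a 0) (measurable_noisePDF v₁ v₂)
    (noisePDF_pos hc.ne_zero₁ hc.ne_zero₂) hM hc.integrable_log_noisePDF
    (g := fun _ => B * (R / a ^ 2 / P)) (fun _ => by positivity)
    (fun v => (hc.outputDensity_le_lintegral hB a 0 P v).trans (by
      rw [ENNReal.ofReal_mul hB0.le]
      gcongr
      exact lintegral_noisePDF_zero_right_le hc.ne_zero₁ hR ha hP v))
    (A := Real.log P - Real.log (B * (R / a ^ 2))) (F := 0) (integrable_zero _ _ _)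
    (ae_of_all _ fun ω => by
      have e : B * (R / a ^ 2 / P) = B * (R / a ^ 2) / P := by ring
      rw [e, Real.log_div (by positivity) (by positivity), Pi.zero_apply]
      linarith)
  refine le_trans (ENNReal.ofReal_le_ofReal (le_of_eq ?_)) h
  simp only [Pi.zero_apply, integral_zero]
  ring

/-- If both outputs depend on the input, then the pre-log factor is at least `3 / 2`. -/
lemma exists_le_channelInfo (hc : IsGaussianChannel μ X Z N v₁ v₂) {a b : ℝ}
    (ha : 0 < a) (hb : 0 < b) :
    ∃ C : ℝ, ∀ P : ℝ, 0 < P →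
      ENNReal.ofReal (3 / 2 * Real.log P - C) ≤ channelInfo μ X Z N a b P := by
  obtain ⟨B, hB0, hB⟩ := exists_complexGaussianPDF_le 1
  obtain ⟨Q, hQ0, hQ⟩ := exists_gaussianPDFReal_le (v₁ / 2)
  obtain ⟨R, hR0, hR⟩ := exists_gaussianPDFReal_le v₂
  obtain ⟨M, hM⟩ := exists_noisePDF_le v₁ v₂
  have hv : v₁ / 2 ≠ 0 := by simpa using hc.ne_zero₁
  set D := (∫⁻ x, ENNReal.ofReal ((1 + |x|) * gaussianPDFReal 0 (v₁ / 2) x)).toReal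
  have hD : ∫⁻ x, ENNReal.ofReal ((1 + |x|) * gaussianPDFReal 0 (v₁ / 2) x) ≤ ENNReal.ofReal D :=
    (ENNReal.ofReal_toReal (lintegral_abs_mul_gaussianPDFReal_lt_top hv)).ge
  have hD0 : 0 ≤ D := ENNReal.toReal_nonneg
  set E := B * ((R * D / a + a * Q / b) / a) with hE
  have hE0 : 0 < E := by positivity
  have hXim := (hasLaw_im_complexGaussian 1).comp hc.input
  -- The loss in replacing `log (1 + |Im Y₁|)` by `log (a√P)`: `Im X` may be small, and `Z` may
  -- cancel the signal.
  set F := fun ω => ‖Z ω‖ - Real.log |(X ω).im| with hFdef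
  have hF : Integrable F μ := by
    refine Integrable.sub ?_ (integrable_log_gaussianReal (by simp) hXim)
    refine hc.integrable_envelope.mono' hc.noise₁.aemeasurable.norm.aestronglyMeasurable
      (ae_of_all _ fun ω => ?_)
    rw [norm_norm, envelope]
    have : 0 ≤ ‖X ω‖ ^ 4 := by positivity
    nlinarith [sq_nonneg (‖Z ω‖ ^ 2 - 1), sq_nonneg (‖Z ω‖ - 1), sq_nonneg (N ω)]
  refine ⟨Real.log E - Real.log a - ∫ ω, Real.log (noisePDF v₁ v₂ (Z ω, N ω)) ∂μ + ∫ ω, F ω ∂μ,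
    fun P hP => ?_⟩
  have h := le_klDiv_additive_noise (hc.aemeasurable_input P) hc.hasLaw_noise
    (hc.indepFun_input P) (measurable_splittingMap a b) (measurable_noisePDF v₁ v₂)
    (noisePDF_pos hc.ne_zero₁ hc.ne_zero₂) hM hc.integrable_log_noisePDF
    (g := fun v => E / P / (1 + |v.1.im|)) (fun _ => by positivity)
    (fun v => (hc.outputDensity_le_lintegral hB a b P v).trans (by
      have h1 := mul_lintegral_noisePDF_le hc.ne_zero₁ hc.ne_zero₂ hD0 hQ hR hD ha hb hP v
      rw [ENNReal.ofReal_div_of_pos (by positivity),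
        ENNReal.le_div_iff_mul_le (by simp; left; positivity) (by simp), hE, mul_div_assoc,
        ENNReal.ofReal_mul hB0.le, mul_assoc]
      gcongr
      rwa [mul_comm]))
    (A := 3 / 2 * Real.log P - Real.log E + Real.log a) hF (by
      filter_upwards [ae_ne_zero_of_hasLaw_gaussianReal (by simp) hXim] with ω hω
      simp only [Function.comp_apply] at hω
      have hx : 0 < |(X ω).im| := abs_pos.2 hω
      have him : (splittingMap a b ((√P : ℂ) * X ω) + (Z ω, N ω)).1.im =
          a * √P * (X ω).im + (Z ω).im := by
        simp [splittingMap, mul_assoc]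
      rw [him, Real.log_div (by positivity) (by positivity),
        Real.log_div (by positivity) (by positivity)]
      -- Reverse triangle inequality, then `(1 + r) + ‖Z‖ ≤ (1 + r)(1 + ‖Z‖)` and `1 + ‖Z‖ ≤ exp
      -- ‖Z‖`, so that the noise becomes additive after taking logarithms.
      have h2 : a * √P * |(X ω).im| ≤
          (1 + |a * √P * (X ω).im + (Z ω).im|) * Real.exp ‖Z ω‖ := by
        have h3 := abs_sub_abs_le_abs_sub (a * √P * (X ω).im) (-(Z ω).im)
        rw [abs_neg, sub_neg_eq_add, abs_mul, abs_of_pos (by positivity : 0 < a * √P)] at h3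
        have h4 := Complex.abs_im_le_norm (Z ω)
        have h5 := Real.add_one_le_exp ‖Z ω‖
        have h6 : (1 + |a * √P * (X ω).im + (Z ω).im|) * (‖Z ω‖ + 1) ≤
          (1 + |a * √P * (X ω).im + (Z ω).im|) * Real.exp ‖Z ω‖ := by gcongr
        nlinarith [mul_nonneg (abs_nonneg (a * √P * (X ω).im + (Z ω).im)) (norm_nonneg (Z ω))]
      have h7 := Real.log_le_log (by positivity) h2
      rw [Real.log_mul (by positivity) (by positivity),
        Real.log_mul (by positivity) (by positivity),
        Real.log_mul (by positivity) (by positivity), Real.log_exp, Real.log_sqrt hP.le] at h7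
      simp only [hFdef]
      linarith)
  refine le_trans (ENNReal.ofReal_le_ofReal (le_of_eq ?_)) h
  ring

end IsGaussianChannel

end LowerBound

/-! ### Limits of quotients with logarithmic growth -/

section Asymptotics

lemma tendsto_affine_div_affine {ι : Type*} {l : Filter ι} {L : ι → ℝ} (hL : Tendsto L l atTop)
    (k A B : ℝ) : Tendsto (fun i => (k * L i + A) / (L i + B)) l (𝓝 k) := by
  have h1 : Tendsto (fun i => k + A / L i) l (𝓝 (k + 0)) :=
    tendsto_const_nhds.add (hL.const_div_atTop A)
  have h2 : Tendsto (fun i => 1 + B / L i) l (𝓝 (1 + 0)) :=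
    tendsto_const_nhds.add (hL.const_div_atTop B)
  have h3 := h1.div h2 (by simp)
  rw [add_zero, add_zero, div_one] at h3
  refine h3.congr' ?_
  filter_upwards [hL.eventually_gt_atTop 0] with i hi
  simp only [Pi.div_apply]
  field_simp

lemma tendsto_div_of_bounds {ι : Type*} {l : Filter ι} {L : ι → ℝ} (hL : Tendsto L l atTop)
    {c : ℝ≥0∞} (hc0 : c ≠ 0) (hc : c ≠ ∞) {x y : ι → ℝ≥0∞} {k A₁ A₂ B₁ B₂ : ℝ}
    (hx₁ : ∀ᶠ i in l, ENNReal.ofReal (k * L i - A₁) / c ≤ x i)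
    (hx₂ : ∀ᶠ i in l, x i ≤ ENNReal.ofReal (k * L i + A₂) / c)
    (hy₁ : ∀ᶠ i in l, ENNReal.ofReal (L i - B₁) / c ≤ y i)
    (hy₂ : ∀ᶠ i in l, y i ≤ ENNReal.ofReal (L i + B₂) / c) :
    Tendsto (fun i => x i / y i) l (𝓝 (ENNReal.ofReal k)) := by
  have hcancel : ∀ u v : ℝ≥0∞, u / c / (v / c) = u / v := fun u v => by
    rw [div_eq_mul_inv u c, div_eq_mul_inv v c]
    exact ENNReal.mul_div_mul_right u v (ENNReal.inv_ne_zero.2 hc) (ENNReal.inv_ne_top.2 hc0)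
  have hlow := ENNReal.tendsto_ofReal (tendsto_affine_div_affine hL k (-A₁) B₂)
  have hup := ENNReal.tendsto_ofReal (tendsto_affine_div_affine hL k A₂ (-B₁))
  refine tendsto_of_tendsto_of_tendsto_of_le_of_le' hlow hup ?_ ?_
  · filter_upwards [hx₁, hy₂, hL.eventually_gt_atTop (-B₂)] with i h1 h2 h3
    rw [ENNReal.ofReal_div_of_pos (by linarith), ← hcancel (ENNReal.ofReal _)]
    exact ENNReal.div_le_div h1 h2
  · filter_upwards [hx₂, hy₁, hL.eventually_gt_atTop B₁] with i h1 h2 h3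
    rw [ENNReal.ofReal_div_of_pos (by linarith), ← hcancel (ENNReal.ofReal _)]
    exact ENNReal.div_le_div h1 h2

end Asymptotics

/-! ### From channel gains to power splitting ratios -/

section Receiver

variable {K : ℕ} {h : Fin K → ℂ} {ρ : Fin K → ℝ}

lemma Theta1_nonneg (hρ : ρ ∈ Set.Icc (0 : Fin K → ℝ) 1) : 0 ≤ Theta1 h ρ :=
  Finset.sum_nonneg fun k _ => mul_nonneg (hρ.1 k) (by positivity)

lemma Theta2_nonneg : 0 ≤ Theta2 h ρ := Finset.sum_nonneg fun k _ => by positivity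

lemma Theta1_le (hρ : ρ ∈ Set.Icc (0 : Fin K → ℝ) 1) : Theta1 h ρ ≤ ∑ k, ‖h k‖ ^ 2 :=
  Finset.sum_le_sum fun k _ => mul_le_of_le_one_left (by positivity) (hρ.2 k)

lemma Theta2_le (hρ : ρ ∈ Set.Icc (0 : Fin K → ℝ) 1) : Theta2 h ρ ≤ ∑ k, ‖h k‖ ^ 4 :=
  Finset.sum_le_sum fun k _ => by
    have h0 : 0 ≤ ρ k := hρ.1 k
    have h1 : ρ k ≤ 1 := hρ.2 k
    exact mul_le_of_le_one_left (by positivity) (pow_le_one₀ (by linarith) (by linarith))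

lemma Theta1_pos (hρ : ρ ∈ Set.Icc (0 : Fin K → ℝ) 1) {k : Fin K} (hk : h k ≠ 0) (hρk : ρ k ≠ 0) :
    0 < Theta1 h ρ :=
  Finset.sum_pos' (fun j _ => mul_nonneg (hρ.1 j) (by positivity))
    ⟨k, Finset.mem_univ k, mul_pos (lt_of_le_of_ne (hρ.1 k) (Ne.symm hρk)) (by positivity)⟩

lemma Theta2_pos {k : Fin K} (hk : h k ≠ 0) (hρk : ρ k ≠ 1) : 0 < Theta2 h ρ :=
  Finset.sum_pos' (fun j _ => by positivity)
    ⟨k, Finset.mem_univ k, by have := sub_ne_zero.2 hρk.symm; positivity⟩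

@[simp]
lemma Theta1_zero : Theta1 h 0 = 0 := by simp [Theta1]

@[simp]
lemma Theta2_one : Theta2 h 1 = 0 := by simp [Theta2]

variable {Ω : Type*} [MeasurableSpace Ω]

lemma splittingInfo_eq (μ : Measure Ω) (X Z : Ω → ℂ) (N : Ω → ℝ) (P : ℝ) :
    splittingInfo μ X Z N h P ρ =
      channelInfo μ X Z N (√(Theta1 h ρ)) (√(Theta2 h ρ)) P / ENNReal.ofReal (Real.log 2) :=
  rfl

/-- The received power tends to infinity as the operating SNR does. -/
lemma tendsto_power_comap_snr (h_ne : h ≠ 0) {σ₁ : ℝ≥0} (hσ₁ : 0 < σ₁) (σ₂ : ℝ≥0) :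
    Tendsto (fun P : ℝ => P) (comap (snr h σ₁ σ₂) atTop) atTop := by
  obtain ⟨k, hk⟩ := Function.ne_iff.1 h_ne
  have hH : 0 < ∑ k, ‖h k‖ ^ 2 := Finset.sum_pos' (fun j _ => by positivity)
    ⟨k, Finset.mem_univ k, by have : h k ≠ 0 := hk; positivity⟩
  have hc : 0 < (∑ k, ‖h k‖ ^ 2) / (σ₁ : ℝ) ^ 2 := by positivity
  have h1 : Tendsto (fun P : ℝ => (∑ k, ‖h k‖ ^ 2) / (σ₁ : ℝ) ^ 2 * P)
      (comap (snr h σ₁ σ₂) atTop) atTop :=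
    tendsto_atTop_mono (fun P => (min_le_left _ _).trans_eq (by ring)) tendsto_comap
  exact (tendsto_const_mul_atTop_of_pos hc).1 h1

namespace IsGaussianChannel

variable {μ : Measure Ω} [IsProbabilityMeasure μ] {X Z : Ω → ℂ} {N : Ω → ℝ} {v₁ v₂ : ℝ≥0}

lemma exists_splittingInfo_le (hc : IsGaussianChannel μ X Z N v₁ v₂) (h : Fin K → ℂ) :
    ∃ C : ℝ, ∀ ρ ∈ Set.Icc (0 : Fin K → ℝ) 1, ∀ P : ℝ, 1 ≤ P →
      splittingInfo μ X Z N h P ρ ≤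
        ENNReal.ofReal (3 / 2 * Real.log P + C) / ENNReal.ofReal (Real.log 2) ∧
      (ρ = 0 ∨ ρ = 1 → splittingInfo μ X Z N h P ρ ≤
        ENNReal.ofReal (Real.log P + C) / ENNReal.ofReal (Real.log 2)) := by
  obtain ⟨C, hC⟩ := hc.exists_channelInfo_le (max (∑ k, ‖h k‖ ^ 2) (∑ k, ‖h k‖ ^ 4))
  refine ⟨C, fun ρ hρ P hP => ?_⟩
  obtain ⟨h1, h2⟩ := hC (√(Theta1 h ρ)) (√(Theta2 h ρ)) P (Real.sqrt_nonneg _)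
    (by rw [Real.sq_sqrt (Theta1_nonneg hρ)]; exact (Theta1_le hρ).trans (le_max_left _ _))
    (by rw [Real.sq_sqrt Theta2_nonneg]; exact (Theta2_le hρ).trans (le_max_right _ _)) hP
  refine ⟨ENNReal.div_le_div_right h1 _, fun h01 => ENNReal.div_le_div_right (h2 ?_) _⟩
  rcases h01 with rfl | rfl <;> simp

lemma exists_conventionalInfo_bounds (hc : IsGaussianChannel μ X Z N v₁ v₂) (h_ne : h ≠ 0) :
    ∃ C₁ C₂ : ℝ, ∀ P : ℝ, 1 ≤ P →
      ENNReal.ofReal (Real.log P - C₁) / ENNReal.ofReal (Real.log 2) ≤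
        conventionalInfo μ X Z N h P ∧
      conventionalInfo μ X Z N h P ≤
        ENNReal.ofReal (Real.log P + C₂) / ENNReal.ofReal (Real.log 2) := by
  obtain ⟨k, hk⟩ := Function.ne_iff.1 h_ne
  obtain ⟨C₁, hC₁⟩ := hc.exists_le_channelInfo_zero_right
    (Real.sqrt_pos.2 (Theta1_pos (h := h) (ρ := 1) ⟨zero_le_one, le_rfl⟩ hk one_ne_zero))
  obtain ⟨C₂, hC₂⟩ := hc.exists_splittingInfo_le h
  refine ⟨C₁, C₂, fun P hP => ⟨?_, max_le ?_ ?_⟩⟩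
  -- The coherent receiver alone supplies the lower bound; the non-coherent one only has to be
  -- bounded above.
  · refine le_trans ?_ (le_max_right _ _)
    rw [splittingInfo_eq, Theta2_one, Real.sqrt_zero]
    exact ENNReal.div_le_div_right (hC₁ P (by linarith)) _
  · exact (hC₂ 0 ⟨le_rfl, zero_le_one⟩ P hP).2 (Or.inl rfl)
  · exact (hC₂ 1 ⟨zero_le_one, le_rfl⟩ P hP).2 (Or.inr rfl)

lemma exists_le_splittingInfo (hc : IsGaussianChannel μ X Z N v₁ v₂) (h1 : 0 < Theta1 h ρ)
    (h2 : 0 < Theta2 h ρ) :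
    ∃ C : ℝ, ∀ P : ℝ, 0 < P →
      ENNReal.ofReal (3 / 2 * Real.log P - C) / ENNReal.ofReal (Real.log 2) ≤
        splittingInfo μ X Z N h P ρ := by
  obtain ⟨C, hC⟩ := hc.exists_le_channelInfo (Real.sqrt_pos.2 h1) (Real.sqrt_pos.2 h2)
  exact ⟨C, fun P hP => ENNReal.div_le_div_right (hC P hP) _⟩

/-- A quantity between the mutual information of one genuinely splitting receiver and the supremum
over all splitting receivers exceeds the conventional one by the factor `3 / 2`. -/
lemma tendsto_div_conventionalInfo (hc : IsGaussianChannel μ X Z N v₁ v₂) (h_ne : h ≠ 0)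
    (h1 : 0 < Theta1 h ρ) (h2 : 0 < Theta2 h ρ) {l : Filter ℝ}
    (hl : Tendsto (fun P : ℝ => P) l atTop) {I : ℝ → ℝ≥0∞}
    (hI₁ : ∀ P, splittingInfo μ X Z N h P ρ ≤ I P)
    (hI₂ : ∀ P, I P ≤ ⨆ ρ ∈ Set.Icc (0 : Fin K → ℝ) 1, splittingInfo μ X Z N h P ρ) :
    Tendsto (fun P => I P / conventionalInfo μ X Z N h P) l (𝓝 (3 / 2)) := by
  obtain ⟨A₁, hA₁⟩ := hc.exists_le_splittingInfo h1 h2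
  obtain ⟨A₂, hA₂⟩ := hc.exists_splittingInfo_le h
  obtain ⟨B₁, B₂, hB⟩ := hc.exists_conventionalInfo_bounds h_ne
  have hP := hl.eventually_ge_atTop 1
  have hlog2 : 0 < Real.log 2 := Real.log_pos one_lt_two
  have e : (3 / 2 : ℝ≥0∞) = ENNReal.ofReal (3 / 2) := by
    rw [ENNReal.ofReal_div_of_pos two_pos, ENNReal.ofReal_ofNat, ENNReal.ofReal_ofNat]
  rw [e]
  refine tendsto_div_of_bounds (c := ENNReal.ofReal (Real.log 2)) (L := fun P => Real.log P)
    (A₁ := A₁) (A₂ := A₂) (B₁ := B₁) (B₂ := B₂) (Real.tendsto_log_atTop.comp hl)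
    (by simpa using hlog2) ENNReal.ofReal_ne_top ?_ ?_ ?_ ?_
  · filter_upwards [hP] with P hP
    exact (hA₁ P (by linarith)).trans (hI₁ P)
  · filter_upwards [hP] with P hP
    exact (hI₂ P).trans (iSup₂_le fun ρ' hρ' => (hA₂ ρ' hρ' P hP).1)
  · filter_upwards [hP] with P hP using (hB P hP).1
  · filter_upwards [hP] with P hP using (hB P hP).2

end IsGaussianChannel

end Receiver

end SplittingReceiver

theorem proposition3 {Ω : Type*} [MeasurableSpace Ω] (μ : Measure Ω) [IsProbabilityMeasure μ]
    {K : ℕ} (h : Fin K → ℂ) (h_ne : h ≠ 0)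
    (σ₁ σ₂ : ℝ≥0) (hσ₁ : 0 < σ₁) (hσ₂ : 0 < σ₂)
    (X Z : Ω → ℂ) (N : Ω → ℝ)
    (hX : HasLaw X (SplittingReceiver.complexGaussian 1) μ)
    (hZ : HasLaw Z (SplittingReceiver.complexGaussian (σ₁ ^ 2)) μ)
    (hN : HasLaw N (gaussianReal 0 (σ₂ ^ 2)) μ)
    (hZN : IndepFun Z N μ) (hXZN : IndepFun X (fun ω => (Z ω, N ω)) μ) :
    -- the limits are for `SNR → ∞`, where the received power `P` varies and all else is fixed
    Tendsto (fun P : ℝ => SplittingReceiver.jointProcessingGain μ X Z N h P)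
        (comap (SplittingReceiver.snr h σ₁ σ₂) atTop) (𝓝 (3 / 2)) ∧
      ((∀ k, h k ≠ 0) → ∀ ρ ∈ Set.Icc (0 : Fin K → ℝ) 1, ρ ≠ 0 → ρ ≠ 1 →
        Tendsto (fun P : ℝ => SplittingReceiver.splittingInfo μ X Z N h P ρ /
            SplittingReceiver.conventionalInfo μ X Z N h P)
          (comap (SplittingReceiver.snr h σ₁ σ₂) atTop) (𝓝 (3 / 2))) := by
  have hc : SplittingReceiver.IsGaussianChannel μ X Z N (σ₁ ^ 2) (σ₂ ^ 2) :=
    ⟨pow_ne_zero 2 hσ₁.ne', pow_ne_zero 2 hσ₂.ne', hX, hZ, hN, hZN, hXZN⟩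
  have hl := SplittingReceiver.tendsto_power_comap_snr h_ne hσ₁ σ₂
  constructor
  · obtain ⟨k, hk⟩ := Function.ne_iff.1 h_ne
    -- An interior point of the cube keeps `Θ₁` and `Θ₂` positive as soon as a single `h k` is
    -- nonzero.
    have hρ : (fun _ => 1 / 2 : Fin K → ℝ) ∈ Set.Icc (0 : Fin K → ℝ) 1 :=
      ⟨fun _ => by norm_num, fun _ => by norm_num⟩
    exact hc.tendsto_div_conventionalInfo h_ne
      (SplittingReceiver.Theta1_pos hρ hk (by norm_num))
      (SplittingReceiver.Theta2_pos (ρ := fun _ => 1 / 2) hk (by norm_num)) hl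
      (fun P => le_iSup₂_of_le _ hρ le_rfl) fun P => le_rfl
  · intro hall ρ hρ h0 h1
    -- The antennas with `ρ i ≠ 0` and `ρ j ≠ 1` may differ, so both channel coefficients must be
    -- nonzero.
    obtain ⟨i, hi⟩ := Function.ne_iff.1 h0
    obtain ⟨j, hj⟩ := Function.ne_iff.1 h1
    exact hc.tendsto_div_conventionalInfo h_ne
      (SplittingReceiver.Theta1_pos hρ (hall i) hi)
      (SplittingReceiver.Theta2_pos (hall j) hj) hl
      (fun P => le_rfl) fun P => le_iSup₂_of_le ρ hρ le_rfl
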